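/- Let $v>0$, $r\ge 0$. A configuration is a locally finite, two-sided infinite collection of particles (balls of radius $r$) on $\mathbb R$ whose centres can be listed as $(x_i)_{i\in\mathbb Z}$ with $x_i+r\le x_{i+1}-r$ for all $i$, $x_i\to\pm\infty$ as $i\to\pm\infty$. Particles are indistinguishable, i.e. two listings that differ by a shift of the index define the same configuration. The space of configurations carries the quotient of the topology and of the $\sigma$-algebra generated by the cylinders $\{x:\ x_i\in C_i,\ i\in I\}$, where $I\subset\mathbb Z$ is finite and the $C_i$ are open intervals. The process $\pi(p,v,r,\mathbb R)$, $0<p\le 1$, is the discrete time Markov process on this space in which, at each step, simultaneously and independently for all $i$, $$x_i^{t+1}=\begin{cases}\min\{x_i^t+v,\;x_{i+1}^t-2r\}&\text{with probability }p,\\ x_i^t&\text{with probability }1-p.\end{cases}$$ A configuration has density $\rho$ if $\lim_{n\to\infty} n/(x_{n-1}-x_0)=\rho$. Theorem. For every $v>0$, $r\ge0$ and every density $\rho\in(0,1/(2r)]$ (with $\rho\in(0,\infty)$ if $r=0$) there are Borel probability measures $\mu^p_\rho$, $0<p\le1$, on the space of configurations such that for each $p$ the measure $\mu^p_\rho$ is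 invariant for $\pi(p,v,r,\mathbb R)$, is nontrivial, i.e. non-atomic (every single configuration has measure zero), and is supported by the configurations of density $\rho$ (these have full measure), and such that $\mu^p_\rho\to\mu^1_\rho$ weakly as $p\to1$. -/

import Mathlib

open Filter Topology MeasureTheory ProbabilityTheory
open scoped unitInterval

namespace Traffic

/-- `x : ℤ → ℝ` lists, in increasing order, the centres of a locally finite bi-infinite family of
non-overlapping balls of radius `r` on the line (for `r = 0` particles may share a site).
For `r > 0` the two limits follow from the first condition; for `r = 0` they say that a bounded
interval contains only finitely many particles and that there are particles on both sides of it. -/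
structure Admissible (r : ℝ) (x : ℤ → ℝ) : Prop where
  separated : ∀ i, x i + r ≤ x (i + 1) - r
  tendsto_atTop : Tendsto x atTop atTop
  tendsto_atBot : Tendsto x atBot atBot

/-- Labelled admissible configurations, with the topology and the `σ`-algebra generated by the
finite cylinders (those induced from the product `ℤ → ℝ`). -/
abbrev Labelled (r : ℝ) : Type := {x : ℤ → ℝ // Admissible r x}

/-- Two labelled configurations are the same up to a shift of the labels. -/
def relabel (r : ℝ) : Setoid (Labelled r) where
  r x y := ∃ k : ℤ, ∀ i, y.1 i = x.1 (i + k)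
  iseqv :=
    { refl := fun x => ⟨0, fun i => by simp⟩
      symm := by
        rintro x y ⟨k, h⟩
        exact ⟨-k, fun i => by rw [h, add_assoc, neg_add_cancel, add_zero]⟩
      trans := by
        rintro x y z ⟨k, h⟩ ⟨l, h'⟩
        exact ⟨l + k, fun i => by rw [h', h, add_assoc]⟩ }

/-- Configurations of indistinguishable particles. -/
def Configuration (r : ℝ) : Type := Quotient (relabel r)

/-- The configuration of indistinguishable particles underlying a labelled one. -/
def forget {r : ℝ} (x : Labelled r) : Configuration r := Quotient.mk (relabel r) x

/-- The quotient topology. -/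
instance (r : ℝ) : TopologicalSpace (Configuration r) :=
  inferInstanceAs (TopologicalSpace (Quotient (relabel r)))

/-- The quotient `σ`-algebra. -/
instance (r : ℝ) : MeasurableSpace (Configuration r) :=
  inferInstanceAs (MeasurableSpace (Quotient (relabel r)))

theorem continuous_forget {r : ℝ} : Continuous (forget (r := r)) :=
  continuous_quotient_mk'

theorem measurable_forget {r : ℝ} : Measurable (forget (r := r)) :=
  measurable_quotient_mk''

instance (r : ℝ) : OpensMeasurableSpace (Configuration r) where
  borel_le := by
    refine MeasurableSpace.generateFrom_le fun U hU => ?_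
    have h : MeasurableSet (forget (r := r) ⁻¹' U) :=
      (IsOpen.preimage continuous_forget hU).measurableSet
    exact measurableSet_quotient.2 h

/-- All particles try to move simultaneously: the particle `i` with `ξ i = true` moves to the right
by `v`, or until it touches the former position of the particle `i + 1`; the others do not move. -/
noncomputable def stepFun (v r : ℝ) (x : ℤ → ℝ) (ξ : ℤ → Bool) (i : ℤ) : ℝ :=
  if ξ i = true then min (x i + v) (x (i + 1) - 2 * r) else x i

theorem le_stepFun {v r : ℝ} (hv : 0 ≤ v) {x : ℤ → ℝ} (hx : Admissible r x) (ξ : ℤ → Bool)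
    (i : ℤ) : x i ≤ stepFun v r x ξ i := by
  have := hx.separated i
  unfold stepFun
  split_ifs
  · exact le_min (by linarith) (by linarith)
  · exact le_rfl

theorem stepFun_le {v r : ℝ} (hv : 0 ≤ v) (x : ℤ → ℝ) (ξ : ℤ → Bool)
    (i : ℤ) : stepFun v r x ξ i ≤ x i + v := by
  unfold stepFun
  split_ifs
  · exact min_le_left _ _
  · linarith

theorem admissible_stepFun {v r : ℝ} (hv : 0 ≤ v) {x : ℤ → ℝ} (hx : Admissible r x)
    (ξ : ℤ → Bool) : Admissible r (stepFun v r x ξ) where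
  separated i := by
    have h1 := hx.separated i
    have h2 := le_stepFun hv hx ξ (i + 1)
    have h3 : stepFun v r x ξ i ≤ x (i + 1) - 2 * r := by
      unfold stepFun
      split_ifs
      · exact min_le_right _ _
      · linarith
    linarith
  tendsto_atTop := tendsto_atTop_mono (le_stepFun hv hx ξ) hx.tendsto_atTop
  tendsto_atBot := tendsto_atBot_mono (stepFun_le hv x ξ)
    (tendsto_atBot_add_const_right _ v hx.tendsto_atBot)

/-- One step of the labelled dynamics. -/
noncomputable def step {v : ℝ} (hv : 0 ≤ v) {r : ℝ} (x : Labelled r) (ξ : ℤ → Bool) : Labelled r :=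
  ⟨stepFun v r x.1 ξ, admissible_stepFun hv x.2 ξ⟩

/-- The law of independent coins indexed by `ℤ`, each of which is `true` with probability `p`. -/
noncomputable def coins (p : I) : Measure (ℤ → Bool) :=
  Measure.infinitePi fun _ : ℤ => bernoulliMeasure true false p

instance (p : I) : IsProbabilityMeasure (coins p) := by
  unfold coins; infer_instance

theorem measurable_step {v : ℝ} (hv : 0 ≤ v) {r : ℝ} :
    Measurable fun q : Labelled r × (ℤ → Bool) => step hv q.1 q.2 := by
  refine Measurable.subtype_mk (measurable_pi_lambda _ fun i => ?_)
  have h (j : ℤ) : Measurable fun q : Labelled r × (ℤ → Bool) => q.1.1 j :=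
    (measurable_pi_apply j).comp (measurable_subtype_coe.comp measurable_fst)
  refine Measurable.ite ?_ (((h i).add_const v).min ((h (i + 1)).sub_const (2 * r))) (h i)
  have hc : Measurable fun q : Labelled r × (ℤ → Bool) => q.2 i :=
    (measurable_pi_apply i).comp measurable_snd
  exact hc (measurableSet_singleton true)

theorem coins_map_shift (p : I) (k : ℤ) :
    (coins p).map (fun ξ i => ξ (i + k)) = coins p := by
  have h := Measure.infinitePi_map_piCongrLeft
    (μ := fun _ : ℤ => bernoulliMeasure true false p) (Equiv.subRight k)
  have e : (fun (ξ : ℤ → Bool) i => ξ (i + k)) =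
      MeasurableEquiv.piCongrLeft (fun _ => Bool) (Equiv.subRight k) := by
    funext ξ i
    have h2 := Equiv.piCongrLeft_apply_apply (fun _ : ℤ => Bool) (Equiv.subRight k) ξ (i + k)
    simp only [Equiv.subRight_apply, add_sub_cancel_right] at h2
    exact h2.symm
  unfold coins
  rw [e]
  exact h

/-- The law of the configuration after one step from the labelled configuration `x`. -/
noncomputable def stepLaw (p : I) {v : ℝ} (hv : 0 ≤ v) {r : ℝ} (x : Labelled r) :
    Measure (Configuration r) :=
  (coins p).map fun ξ => forget (step hv x ξ)

theorem stepLaw_congr (p : I) {v : ℝ} (hv : 0 ≤ v) {r : ℝ} (x y : Labelled r)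
    (h : (relabel r).r x y) : stepLaw p hv x = stepLaw p hv y := by
  obtain ⟨k, hk⟩ := h
  have hy : Measurable fun ξ => forget (step hv y ξ) :=
    measurable_forget.comp ((measurable_step hv).comp measurable_prodMk_left)
  have hs : Measurable fun (ξ : ℤ → Bool) (i : ℤ) => ξ (i + k) :=
    measurable_pi_lambda _ fun i => measurable_pi_apply (i + k)
  unfold stepLaw
  conv_rhs => rw [← coins_map_shift p k, Measure.map_map hy hs]
  congr 1
  funext ξ
  refine Quotient.sound (s := relabel r) ⟨k, fun i => ?_⟩
  simp only [step, stepFun, hk]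
  rw [add_right_comm]

/-- The discrete time Markov process with indistinguishable particles, given by its one-step
transition kernel. -/
noncomputable def process (p : I) {v : ℝ} (hv : 0 ≤ v) (r : ℝ) :
    Kernel (Configuration r) (Configuration r) where
  toFun := Quotient.lift (stepLaw p hv) (stepLaw_congr p hv)
  measurable' := by
    refine measurable_from_quotient.2 ?_
    have h : Measurable fun q : Labelled r × (ℤ → Bool) => forget (step hv q.1 q.2) :=
      measurable_forget.comp (measurable_step hv)
    have h2 : (fun x : Labelled r => stepLaw p hv x) =
        fun x => ((coins p).map (Prod.mk x)).map fun q => forget (step hv q.1 q.2) := by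
      funext x
      exact (Measure.map_map h measurable_prodMk_left).symm
    change Measurable fun x : Labelled r => stepLaw p hv x
    rw [h2]
    exact (Measure.measurable_map _ h).comp Measurable.map_prodMk_left

/-- The configuration `c` has density `ρ`: `n / (x_{n-1} - x_0) → ρ` for each labelling `x` of `c`
(the limit does not depend on the labelling). -/
def HasDensity {r : ℝ} (c : Configuration r) (ρ : ℝ) : Prop :=
  ∀ x : Labelled r, forget x = c →
    Tendsto (fun n : ℕ => (n : ℝ) / (x.1 ((n : ℤ) - 1) - x.1 0)) atTop (𝓝 ρ)

end Traffic

/-!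
Measure the free space between neighbouring balls in units of `v`. If all gaps are integers, they
stay integers, and the dynamics of the gaps `n i` is a discrete time tandem of queues (a parallel
zero range process): a particle with nonzero gap moves with probability `p`, which takes one unit
from its own gap and adds one to the gap behind it. Such a queue has a stationary law under which
its output is independent of its new length and has the same law as its input (Burke's theorem,
`map_nextGap_jump`): the gap is nonzero with some probability `a`, and is then geometric. As the
output is determined by the old state alone, independent gaps are invariant (`map_tandem`). For
every mean `m ≥ 0` and every `p` there is a choice of the parameters which gives this mean
(`gapRate`), and it is continuous up to `p = 1`; the mean `m` is chosen so that neighbours have mean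
distance `2 * r + v * m = ρ⁻¹`.

Independent gaps together with Lebesgue measure for the position of particle `0` form an infinite
measure (`rootedMeasure`) on labelled configurations. It is invariant under the dynamics, and also
under relabelling. Its restriction to the event that particle `0` is the last one in `(-∞, 0]`, a
fundamental domain of relabelling, has mass `ρ⁻¹`; normalized and pushed forward to unlabelled
configurations it gives `μ p`. Invariance holds because the dynamics commutes with relabelling and
two fundamental domains give the same mass to a relabelling invariant event
(`invariant_configurationMeasure`). Single configurations are null since the position of particle
`0` has a continuous law and there are countably many labellings; the density comes from the strong
law of large numbers.

For the weak convergence, the gap laws for all `p` are realized as quantile functions of the same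
uniform random variables. Along any sequence `p → 1` each gap is then almost surely eventually constant, so that the
labelled configurations converge, and Fatou's lemma yields the portmanteau criterion on open sets
(`configurationMeasure_le_liminf`).
-/

namespace Traffic

/-! ### The stationary law of a single gap -/

/-- The quantile function of the law on `ℕ` which gives mass `a * z ^ n` to `(n, ∞)`, that is, a
value is nonzero with probability `a` and is then geometric with ratio `z`. Applied to one uniform
random variable `u`, it couples these laws for all parameters. (At `u = 0`, a null event, the set
may be empty and the value is then the junk value `0`.) -/
noncomputable def gapQuantile (a z : ℝ) (u : I) : ℕ := sInf {n | a * z ^ n ≤ u}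

/-- The law of a gap, in units of the jump length. -/
noncomputable def gapLaw (a z : ℝ) : Measure ℕ := (volume : Measure I).map (gapQuantile a z)

section

variable {a z : ℝ}

theorem gapQuantile_eq_succ_iff (ha : 0 ≤ a) (hz : 0 ≤ z) (hz1 : z ≤ 1) (n : ℕ) (u : I) :
    gapQuantile a z u = n + 1 ↔ a * z ^ (n + 1) ≤ u ∧ u < a * z ^ n := by
  have hup : ∀ k₁ k₂ : ℕ, k₁ ≤ k₂ → k₁ ∈ {n | a * z ^ n ≤ u} → k₂ ∈ {n | a * z ^ n ≤ (u : ℝ)} :=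
    fun k₁ k₂ h h1 =>
      (mul_le_mul_of_nonneg_left (pow_le_pow_of_le_one hz hz1 h) ha).trans h1
  unfold gapQuantile
  rw [Nat.sInf_upward_closed_eq_succ_iff hup]
  simp

theorem gapQuantile_eq_zero_of_le {u : I} (h : a ≤ u) : gapQuantile a z u = 0 := by
  unfold gapQuantile
  rw [Nat.sInf_eq_zero]
  left
  simpa using h

theorem ae_gapQuantile_eq_zero_iff (ha1 : a ≤ 1) (hz : 0 ≤ z) (hz1 : z < 1) :
    ∀ᵐ u : I, gapQuantile a z u = 0 ↔ a ≤ u := by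
  have h0 : ∀ᵐ u : I, u ≠ 0 := measure_eq_zero_iff_ae_notMem.1 (measure_singleton (0 : I))
  filter_upwards [h0] with u hu
  refine ⟨fun h => ?_, gapQuantile_eq_zero_of_le⟩
  unfold gapQuantile at h
  rw [Nat.sInf_eq_zero] at h
  have hu' : (0 : ℝ) < u := unitInterval.pos_iff_ne_zero.2 hu
  rcases h with h | h
  · simpa using h
  · obtain ⟨n, hn⟩ := exists_pow_lt_of_lt_one hu' hz1
    have : n ∈ {n | a * z ^ n ≤ u} :=
      (mul_le_of_le_one_left (by positivity) ha1).trans hn.le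
    rw [h] at this
    exact this.elim

theorem measurable_gapQuantile (ha : 0 ≤ a) (hz : 0 ≤ z) (hz1 : z ≤ 1) :
    Measurable (gapQuantile a z) := by
  have h (n : ℕ) : MeasurableSet (gapQuantile a z ⁻¹' {n + 1}) := by
    have : gapQuantile a z ⁻¹' {n + 1} = {u : I | a * z ^ (n + 1) ≤ u ∧ (u : ℝ) < a * z ^ n} := by
      ext u
      exact gapQuantile_eq_succ_iff ha hz hz1 n u
    rw [this]
    exact (measurableSet_le measurable_const measurable_subtype_coe).inter
      (measurableSet_lt measurable_subtype_coe measurable_const)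
  refine measurable_to_countable' fun n => ?_
  cases n with
  | succ n => exact h n
  | zero =>
    have : gapQuantile a z ⁻¹' {0} = (⋃ n : ℕ, gapQuantile a z ⁻¹' {n + 1})ᶜ := by
      ext u
      simp only [Set.mem_preimage, Set.mem_singleton_iff, Set.mem_compl_iff, Set.mem_iUnion,
        not_exists]
      constructor
      · intro h
        simp [h]
      · intro h
        by_contra h0
        obtain ⟨n, hn⟩ := Nat.exists_eq_succ_of_ne_zero h0
        exact h n hn
    rw [this]
    exact (MeasurableSet.iUnion h).compl

theorem isProbabilityMeasure_gapLaw (ha : 0 ≤ a) (hz : 0 ≤ z) (hz1 : z ≤ 1) :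
    IsProbabilityMeasure (gapLaw a z) :=
  Measure.isProbabilityMeasure_map (measurable_gapQuantile ha hz hz1).aemeasurable

theorem gapLaw_singleton_succ (ha : 0 ≤ a) (ha1 : a ≤ 1) (hz : 0 ≤ z) (hz1 : z ≤ 1) (n : ℕ) :
    gapLaw a z {n + 1} = ENNReal.ofReal (a * (1 - z) * z ^ n) := by
  have h (k : ℕ) : a * z ^ k ∈ I :=
    ⟨by positivity, mul_le_one₀ ha1 (by positivity) (pow_le_one₀ hz hz1)⟩
  rw [gapLaw, Measure.map_apply (measurable_gapQuantile ha hz hz1) (measurableSet_singleton _)]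
  have : gapQuantile a z ⁻¹' {n + 1} = Set.Ico (⟨_, h (n + 1)⟩ : I) ⟨_, h n⟩ := by
    ext u
    exact gapQuantile_eq_succ_iff ha hz hz1 n u
  rw [this, unitInterval.volume_Ico]
  congr 1
  simp only
  ring

theorem gapLaw_singleton_zero (ha : 0 ≤ a) (ha1 : a ≤ 1) (hz : 0 ≤ z) (hz1 : z < 1) :
    gapLaw a z {0} = ENNReal.ofReal (1 - a) := by
  rw [gapLaw, Measure.map_apply (measurable_gapQuantile ha hz hz1.le) (measurableSet_singleton _),
    ← unitInterval.volume_Ici ⟨a, ha, ha1⟩]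
  refine measure_congr ?_
  filter_upwards [ae_gapQuantile_eq_zero_iff ha1 hz hz1] with u hu
  exact propext hu

/-- A gap is nonzero with probability `a`, and then has mean `1 / (1 - z)`. -/
theorem lintegral_gapLaw (ha : 0 ≤ a) (ha1 : a ≤ 1) (hz : 0 ≤ z) (hz1 : z < 1) :
    ∫⁻ n, ENNReal.ofReal n ∂(gapLaw a z) = ENNReal.ofReal (a / (1 - z)) := by
  rw [lintegral_countable', tsum_eq_zero_add' ENNReal.summable]
  simp only [gapLaw_singleton_succ ha ha1 hz hz1.le]
  have hs := (hasSum_choose_mul_geometric_of_norm_lt_one (𝕜 := ℝ) 1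
    (by rwa [Real.norm_of_nonneg hz])).mul_left (a * (1 - z))
  have h1 : 0 < 1 - z := by linarith
  have : (a / (1 - z)) = a * (1 - z) * (1 / (1 - z) ^ (1 + 1)) := by
    field_simp
  rw [this, ← hs.tsum_eq, ENNReal.ofReal_tsum_of_nonneg (fun n => by positivity) hs.summable]
  simp only [CharP.cast_eq_zero, ENNReal.ofReal_zero, zero_mul, zero_add]
  refine tsum_congr fun n => ?_
  rw [← ENNReal.ofReal_mul (by positivity)]
  congr 1
  simp only [Nat.choose_one_right]
  ring

/-- For all but countably many `u` the quantile function is locally constant in the parameters. -/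
theorem ae_eventually_gapQuantile_eq {ι : Type*} {l : Filter ι} {a' z' : ι → ℝ}
    (ha : 0 ≤ a) (ha1 : a ≤ 1) (hz : 0 ≤ z) (hz1 : z < 1) (ha' : ∀ i, 0 ≤ a' i)
    (hz' : ∀ i, 0 ≤ z' i) (hz1' : ∀ i, z' i ≤ 1) (hla : Tendsto a' l (𝓝 a))
    (hlz : Tendsto z' l (𝓝 z)) :
    ∀ᵐ u : I, ∀ᶠ i in l, gapQuantile (a' i) (z' i) u = gapQuantile a z u := by
  have hne : ∀ᵐ u : I, ∀ n : ℕ, (u : ℝ) ≠ a * z ^ n := by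
    rw [ae_all_iff]
    intro n
    have h : a * z ^ n ∈ I :=
      ⟨by positivity, mul_le_one₀ ha1 (by positivity) (pow_le_one₀ hz hz1.le)⟩
    filter_upwards [measure_eq_zero_iff_ae_notMem.1 (measure_singleton (⟨_, h⟩ : I))] with u hu hu'
    exact hu (Subtype.ext hu')
  have hlim (n : ℕ) : Tendsto (fun i => a' i * z' i ^ n) l (𝓝 (a * z ^ n)) := hla.mul (hlz.pow n)
  filter_upwards [hne, ae_gapQuantile_eq_zero_iff ha1 hz hz1] with u hu h0
  cases hn : gapQuantile a z u with
  | zero =>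
    have h1 : a < u := lt_of_le_of_ne (h0.1 hn) (by simpa using (hu 0).symm)
    filter_upwards [hla.eventually_lt_const h1] with i hi
    exact gapQuantile_eq_zero_of_le hi.le
  | succ n =>
    obtain ⟨h1, h2⟩ := (gapQuantile_eq_succ_iff ha hz hz1.le n u).1 hn
    have h1' := lt_of_le_of_ne h1 (hu (n + 1)).symm
    filter_upwards [(hlim (n + 1)).eventually_lt_const h1', (hlim n).eventually_const_lt h2]
      with i hi1 hi2
    exact (gapQuantile_eq_succ_iff (ha' i) (hz' i) (hz1' i) n u).2 ⟨hi1.le, hi2⟩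

end

/-! ### One particle: output equals input in law -/

/-- Whether a particle with gap `w.1` ahead of it and coin `w.2` moves. -/
def jump (w : ℕ × Bool) : Bool := w.2 && decide (w.1 ≠ 0)

/-- The gap ahead of a particle after one step, `e` telling whether the next particle moves. -/
def nextGap (w : ℕ × Bool) (e : Bool) : ℕ := w.1 - (jump w).toNat + e.toNat

theorem lintegral_bernoulliMeasure (p : I) (f : Bool → ENNReal) :
    ∫⁻ b, f b ∂(bernoulliMeasure true false p) =
      ENNReal.ofReal p * f true + ENNReal.ofReal (1 - p) * f false := by
  rw [bernoulliMeasure_def]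
  have e1 : ((unitInterval.toNNReal p : NNReal) : ENNReal) = ENNReal.ofReal p := by
    rw [← ENNReal.ofReal_coe_nnreal]; rfl
  have e2 : ((unitInterval.toNNReal (σ p) : NNReal) : ENNReal) = ENNReal.ofReal (1 - p) := by
    rw [← ENNReal.ofReal_coe_nnreal]; rfl
  simp [lintegral_add_measure, lintegral_smul_measure, ENNReal.smul_def, e1, e2]

theorem bernoulliMeasure_singleton (p : I) (e : Bool) :
    bernoulliMeasure true false p {e} = ENNReal.ofReal (if e then (p : ℝ) else 1 - p) := by
  rw [← lintegral_indicator_one (measurableSet_singleton e), lintegral_bernoulliMeasure]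
  cases e <;> simp

/-- A gap which is fed at rate `q` and emptied at rate `p` is a stationary queue whose output in
one step is independent of its new length and again has rate `q`: the one-step form of Burke's
theorem. -/
theorem map_nextGap_jump {a z : ℝ} (ha : 0 ≤ a) (ha1 : a ≤ 1) (hz : 0 ≤ z) (hz1 : z < 1) (p q : I)
    (hq : (q : ℝ) = p * a) (hbal : z * (1 - a) = a * (1 - z) * (1 - p)) :
    (((gapLaw a z).prod (bernoulliMeasure true false p)).prod (bernoulliMeasure true false q)).map
      (fun w => (nextGap w.1 w.2, jump w.1)) =
      (gapLaw a z).prod (bernoulliMeasure true false q) := by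
  have := isProbabilityMeasure_gapLaw ha hz hz1.le
  have hp0 := p.2.1
  have hp1 : 0 ≤ 1 - (p : ℝ) := by linarith [p.2.2]
  have hq0 := q.2.1
  have hq1 : 0 ≤ 1 - (q : ℝ) := by linarith [q.2.2]
  have ha2 : 0 ≤ 1 - a := by linarith
  have hz2 : 0 ≤ 1 - z := by linarith
  refine Measure.ext_of_singleton fun ⟨k, e⟩ => ?_
  rw [Measure.map_apply (measurable_of_countable _) (measurableSet_singleton _),
    Measure.prod_apply_symm (Set.to_countable _).measurableSet, lintegral_bernoulliMeasure,
    Measure.prod_apply_symm (Set.to_countable _).measurableSet, lintegral_bernoulliMeasure,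
    Measure.prod_apply_symm (Set.to_countable _).measurableSet, lintegral_bernoulliMeasure,
    ← Set.singleton_prod_singleton, Measure.prod_prod, bernoulliMeasure_singleton]
  have hpre (b e' : Bool) : (fun n => (n, b)) ⁻¹' ((fun w => (w, e')) ⁻¹'
      ((fun w : (ℕ × Bool) × Bool => (nextGap w.1 w.2, jump w.1)) ⁻¹' {k} ×ˢ {e})) =
      {n | n - (b && decide (n ≠ 0)).toNat + e'.toNat = k ∧ (b && decide (n ≠ 0)) = e} := by
    ext n
    simp [nextGap, jump]
  simp only [hpre]
  have hsucc (k : ℕ) : gapLaw a z {k + 1} = ENNReal.ofReal (a * (1 - z) * z ^ k) :=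
    gapLaw_singleton_succ ha ha1 hz hz1.le k
  have hzero : gapLaw a z {0} = ENNReal.ofReal (1 - a) := gapLaw_singleton_zero ha ha1 hz hz1
  have hempty (b e' : Bool) (h : ∀ n : ℕ, ¬(n - (b && decide (n ≠ 0)).toNat + e'.toNat = k ∧
      (b && decide (n ≠ 0)) = e)) : gapLaw a z {n | n - (b && decide (n ≠ 0)).toNat + e'.toNat = k ∧
      (b && decide (n ≠ 0)) = e} = ENNReal.ofReal 0 := by
    rw [ENNReal.ofReal_zero, ← measure_empty (μ := gapLaw a z)]
    congr 1
    exact Set.eq_empty_of_forall_notMem h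
  have hone (b e' : Bool) (m : ℕ) (h : ∀ n : ℕ, (n - (b && decide (n ≠ 0)).toNat + e'.toNat = k ∧
      (b && decide (n ≠ 0)) = e) ↔ n = m) : gapLaw a z {n | n - (b && decide (n ≠ 0)).toNat +
      e'.toNat = k ∧ (b && decide (n ≠ 0)) = e} = gapLaw a z {m} := by
    congr 1
    ext n
    exact h n
  have hpos (k : ℕ) : 0 ≤ a * (1 - z) * z ^ k := by positivity
  have hreal {x₁ x₂ x₃ x₄ y w : ℝ} (h₁ : 0 ≤ x₁) (h₂ : 0 ≤ x₂) (h₃ : 0 ≤ x₃) (h₄ : 0 ≤ x₄)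
      (hy : 0 ≤ y) (h : q * (p * x₁ + (1 - p) * x₂) + (1 - q) * (p * x₃ + (1 - p) * x₄) = y * w) :
      ENNReal.ofReal q * (ENNReal.ofReal p * ENNReal.ofReal x₁ +
        ENNReal.ofReal (1 - p) * ENNReal.ofReal x₂) + ENNReal.ofReal (1 - q) *
        (ENNReal.ofReal p * ENNReal.ofReal x₃ + ENNReal.ofReal (1 - p) * ENNReal.ofReal x₄) =
      ENNReal.ofReal y * ENNReal.ofReal w := by
    rw [← ENNReal.ofReal_mul hp0, ← ENNReal.ofReal_mul hp1, ← ENNReal.ofReal_mul hp0,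
      ← ENNReal.ofReal_mul hp1, ← ENNReal.ofReal_add (by positivity) (by positivity),
      ← ENNReal.ofReal_add (by positivity) (by positivity), ← ENNReal.ofReal_mul hq0,
      ← ENNReal.ofReal_mul hq1, ← ENNReal.ofReal_add (by positivity) (by positivity),
      ← ENNReal.ofReal_mul hy, h]
  rcases e with _ | _
  · rcases k with _ | _ | k
    · rw [hempty true true (by rintro (_ | n) <;> simp),
        hempty false true (by rintro (_ | n) <;> simp),
        hone true false 0 (by rintro (_ | n) <;> simp),
        hone false false 0 (by rintro (_ | n) <;> simp),
        hzero]
      refine hreal le_rfl le_rfl ha2 ha2 ha2 ?_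
      simp only [Bool.false_eq_true, if_false, hq]
      ring
    · rw [hone true true 0 (by rintro (_ | n) <;> simp),
        hone false true 0 (by rintro (_ | n) <;> simp),
        hempty true false (by rintro (_ | n) <;> simp),
        hone false false (0 + 1) (by rintro (_ | n) <;> simp),
        hzero, hsucc]
      refine hreal ha2 ha2 le_rfl (hpos _) (hpos _) ?_
      simp only [Bool.false_eq_true, if_false, hq]
      linear_combination p * a * hbal
    · rw [hempty true true (by rintro (_ | n) <;> simp),
        hone false true (k + 1) (by rintro (_ | n) <;> simp),
        hempty true false (by rintro (_ | n) <;> simp),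
        hone false false (k + 1 + 1) (by rintro (_ | n) <;> simp),
        hsucc, hsucc]
      refine hreal le_rfl (hpos _) le_rfl (hpos _) (hpos _) ?_
      simp only [Bool.false_eq_true, if_false, hq]
      linear_combination -(p * a * (1 - z) * z ^ k) * hbal
  · rcases k with _ | k
    · rw [hempty true true (by rintro (_ | n) <;> simp),
        hempty false true (by rintro (_ | n) <;> simp),
        hone true false (0 + 1) (by rintro (_ | n) <;> simp),
        hempty false false (by rintro (_ | n) <;> simp),
        hzero, hsucc]
      refine hreal le_rfl le_rfl (hpos _) le_rfl ha2 ?_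
      simp only [if_true, hq]
      linear_combination -(p * a) * hbal
    · rw [hone true true (k + 1) (by rintro (_ | n) <;> simp),
        hempty false true (by rintro (_ | n) <;> simp),
        hone true false (k + 1 + 1) (by rintro (_ | n) <;> simp),
        hempty false false (by rintro (_ | n) <;> simp),
        hsucc, hsucc]
      refine hreal (hpos _) le_rfl (hpos _) le_rfl (hpos _) ?_
      simp only [if_true, hq]
      linear_combination a * p * (1 - z) * z ^ k * hbal

/-! ### Infinitely many particles -/

/-- Burke's theorem for an infinite tandem: if the output `j w` of a single site, fed with an
independent input of law `β`, has law `β` and is independent of the new state `f w e`, which has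
law `π`, then sites with independent states produce sites with independent states of law `π`.
The output of a site is a function of its old state alone, so that no infinite propagation
occurs. -/
theorem map_tandem {W N E : Type*} [MeasurableSpace W] [MeasurableSpace N] [MeasurableSpace E]
    {κ : Measure W} {π : Measure N} {β : Measure E} [IsProbabilityMeasure κ]
    [IsProbabilityMeasure π] [IsProbabilityMeasure β] {f : W → E → N} {j : W → E}
    (hf : Measurable (Function.uncurry f)) (hj : Measurable j)
    (h : (κ.prod β).map (fun w => (f w.1 w.2, j w.1)) = π.prod β) :
    (Measure.infinitePi fun _ : ℤ => κ).map (fun ω i => f (ω i) (j (ω (i + 1)))) =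
      Measure.infinitePi fun _ : ℤ => π := by
  set Q := Measure.infinitePi fun _ : ℤ => κ with hQ
  have hfj : Measurable fun w : W × E => (f w.1 w.2, j w.1) :=
    hf.prodMk (hj.comp measurable_fst)
  have hjβ : κ.map j = β := by
    have h2 := congrArg (Measure.map Prod.snd) h
    rw [Measure.map_map measurable_snd hfj] at h2
    have e : (Prod.snd ∘ fun w : W × E => (f w.1 w.2, j w.1)) = j ∘ Prod.fst := rfl
    rw [e, ← Measure.map_map hj measurable_fst] at h2
    simpa using h2
  have hnext (i : ℤ) : Measurable fun ω : ℤ → W => f (ω i) (j (ω (i + 1))) := by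
    have : Measurable fun ω : ℤ → W => (ω i, j (ω (i + 1))) :=
      (measurable_pi_apply i).prodMk (hj.comp (measurable_pi_apply (i + 1)))
    exact hf.comp this
  have hindep : iIndep (fun i : ℤ => MeasurableSpace.comap (fun ω : ℤ → W => ω i) inferInstance)
      Q := iIndepFun_infinitePi (X := fun (_ : ℤ) (w : W) => w) (fun _ => measurable_id)
  -- The output of the leftmost site of a block is independent of the new states in the block.
  have key (L : ℕ) : ∀ (a : ℤ) (t : ℤ → Set N), (∀ i, MeasurableSet (t i)) →
      ∀ B : Set E, MeasurableSet B →
      Q {ω | j (ω a) ∈ B ∧ ∀ i ∈ Finset.Ico a (a + L), f (ω i) (j (ω (i + 1))) ∈ t i} =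
        β B * ∏ i ∈ Finset.Ico a (a + L), π (t i) := by
    induction L with
    | zero =>
      intro a t ht B hB
      have : {ω : ℤ → W | j (ω a) ∈ B ∧ ∀ i ∈ Finset.Ico a (a + (0 : ℕ)),
          f (ω i) (j (ω (i + 1))) ∈ t i} = Function.eval a ⁻¹' (j ⁻¹' B) := by
        ext ω
        simp
      rw [this, (measurePreserving_eval_infinitePi (fun _ : ℤ => κ) a).measure_preimage
        (hj hB).nullMeasurableSet, ← Measure.map_apply hj hB, hjβ]
      simp
    | succ L ih =>
      intro a t ht B hB
      set s := Finset.Ico (a + 1) (a + 1 + L) with hs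
      set c := ∏ i ∈ s, π (t i) with hc
      have hc1 : c ≤ 1 := Finset.prod_le_one' fun i _ => prob_le_one
      have hIco : Finset.Ico a (a + (L + 1 : ℕ)) = insert a s := by
        ext i
        simp [hs]
        omega
      have has : a ∉ s := by simp [hs]
      set R : Set (ℤ → W) := {ω | ∀ i ∈ s, f (ω i) (j (ω (i + 1))) ∈ t i} with hR
      have hRm : MeasurableSet R := by
        have : R = ⋂ i ∈ s, (fun ω : ℤ → W => f (ω i) (j (ω (i + 1)))) ⁻¹' t i := by
          ext ω
          simp [hR]
        rw [this]
        exact Finset.measurableSet_biInter s fun i _ => hnext i (ht i)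
      have hpair : Measurable fun ω : ℤ → W => (ω a, j (ω (a + 1))) :=
        (measurable_pi_apply a).prodMk (hj.comp (measurable_pi_apply (a + 1)))
      have hlaw : (Q.restrict R).map (fun ω => (ω a, j (ω (a + 1)))) = κ.prod (c • β) := by
        have : IsFiniteMeasure (c • β) :=
          ⟨by simpa using hc1.trans_lt ENNReal.one_lt_top⟩
        refine (Measure.prod_eq fun A D hA hD => ?_).symm
        rw [Measure.map_apply hpair (hA.prod hD),
          Measure.restrict_apply (hpair (hA.prod hD))]
        have hset : (fun ω : ℤ → W => (ω a, j (ω (a + 1)))) ⁻¹' A ×ˢ D ∩ R =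
            (fun ω : ℤ → W => ω a) ⁻¹' A ∩ {ω | j (ω (a + 1)) ∈ D ∧
              ∀ i ∈ s, f (ω i) (j (ω (i + 1))) ∈ t i} := by
          ext ω
          simp [hR, and_assoc]
        have hle (i : ℤ) : MeasurableSpace.comap (fun ω : ℤ → W => ω i) inferInstance ≤
            (inferInstance : MeasurableSpace (ℤ → W)) := (measurable_pi_apply i).comap_le
        have hind := indep_iSup_of_disjoint hle hindep
          (S := {a}) (T := Set.Ioi a) (by simp)
        have hev (i : ℤ) (hi : a < i) : Measurable[⨆ i ∈ Set.Ioi a, MeasurableSpace.comap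
            (fun ω : ℤ → W => ω i) inferInstance] fun ω : ℤ → W => ω i :=
          (comap_measurable _).mono
            (le_iSup₂_of_le (f := fun i (_ : i ∈ Set.Ioi a) => MeasurableSpace.comap
              (fun ω : ℤ → W => ω i) inferInstance) i hi le_rfl) le_rfl
        have hA' : MeasurableSet[⨆ i ∈ ({a} : Set ℤ), MeasurableSpace.comap
            (fun ω : ℤ → W => ω i) inferInstance] ((fun ω : ℤ → W => ω a) ⁻¹' A) := by
          rw [iSup_singleton]
          exact ⟨A, hA, rfl⟩
        have hD' : MeasurableSet[⨆ i ∈ Set.Ioi a, MeasurableSpace.comap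
            (fun ω : ℤ → W => ω i) inferInstance] {ω | j (ω (a + 1)) ∈ D ∧
              ∀ i ∈ s, f (ω i) (j (ω (i + 1))) ∈ t i} := by
          have : {ω : ℤ → W | j (ω (a + 1)) ∈ D ∧ ∀ i ∈ s, f (ω i) (j (ω (i + 1))) ∈ t i} =
              (fun ω : ℤ → W => j (ω (a + 1))) ⁻¹' D ∩
                ⋂ i ∈ s, (fun ω : ℤ → W => f (ω i) (j (ω (i + 1)))) ⁻¹' t i := by
            ext ω
            simp
          rw [this]
          refine MeasurableSet.inter (hj.comp (hev (a + 1) (by omega)) hD)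
            (Finset.measurableSet_biInter s fun i hi => ?_)
          have hi' : a < i := by
            have := (Finset.mem_Ico.1 hi).1
            omega
          exact hf.comp ((hev i hi').prodMk (hj.comp (hev (i + 1) (by omega)))) (ht i)
        rw [hset, (Indep_iff _ _ _).1 hind _ _ hA' hD', ih (a + 1) t ht D hD]
        have := (measurePreserving_eval_infinitePi (fun _ : ℤ => κ) a).measure_preimage
          hA.nullMeasurableSet
        rw [← hQ] at this
        change Q (Function.eval a ⁻¹' A) * _ = _
        rw [this, Measure.smul_apply, smul_eq_mul, mul_comm c]
      have hset : {ω : ℤ → W | j (ω a) ∈ B ∧ ∀ i ∈ Finset.Ico a (a + (L + 1 : ℕ)),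
          f (ω i) (j (ω (i + 1))) ∈ t i} = (fun ω : ℤ → W => (ω a, j (ω (a + 1)))) ⁻¹'
            ((fun w : W × E => (f w.1 w.2, j w.1)) ⁻¹' (t a ×ˢ B)) ∩ R := by
        ext ω
        simp only [hIco, Finset.forall_mem_insert, hR, Set.mem_ofPred_eq, Set.mem_inter_iff,
          Set.mem_preimage, Set.mem_prod]
        tauto
      have hm := hfj ((ht a).prod hB)
      rw [hset, ← Measure.restrict_apply (hpair hm), ← Measure.map_apply hpair hm, hlaw,
        Measure.prod_smul_right, Measure.smul_apply, ← Measure.map_apply hfj ((ht a).prod hB), h,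
        Measure.prod_prod, hIco, Finset.prod_insert has, smul_eq_mul]
      ring
  refine Measure.eq_infinitePi _ fun s t ht => ?_
  classical
  obtain ⟨a, L, hsL⟩ : ∃ (a : ℤ) (L : ℕ), s ⊆ Finset.Ico a (a + L) := by
    obtain ⟨b, hb⟩ := s.bddAbove
    obtain ⟨a, ha⟩ := s.bddBelow
    refine ⟨a, (b + 1 - a).toNat, fun i hi => ?_⟩
    have h1 := hb hi
    have h2 := ha hi
    rw [Finset.mem_Ico]
    omega
  have hmeas : Measurable fun (ω : ℤ → W) (i : ℤ) => f (ω i) (j (ω (i + 1))) :=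
    measurable_pi_lambda _ hnext
  rw [Measure.map_apply hmeas (.pi s.countable_toSet fun i _ => ht i)]
  have hk := key L a (fun i => if i ∈ s then t i else Set.univ)
    (fun i => by split_ifs; exacts [ht i, .univ]) Set.univ .univ
  rw [measure_univ, one_mul] at hk
  convert hk using 1
  · congr 1
    ext ω
    simp only [Set.mem_preimage, Set.mem_pi, Finset.mem_coe, Set.mem_univ, true_and,
      Set.mem_ofPred_eq]
    constructor
    · intro h i _
      split_ifs with hi
      exacts [h i hi, trivial]
    · intro h i hi
      simpa [hi] using h i (hsL hi)
  · rw [← Finset.prod_subset hsL]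
    · exact Finset.prod_congr rfl fun i hi => by simp [hi]
    · intro i _ hi
      simp [hi]

/-- The gaps after one step. -/
def gapStep (n : ℤ → ℕ) (ξ : ℤ → Bool) (i : ℤ) : ℕ :=
  nextGap (n i, ξ i) (jump (n (i + 1), ξ (i + 1)))

theorem map_pair_infinitePi {ι X Y : Type*} [MeasurableSpace X] [MeasurableSpace Y]
    (μ : Measure X) (ν : Measure Y) [IsProbabilityMeasure μ] [IsProbabilityMeasure ν] :
    ((Measure.infinitePi fun _ : ι => μ).prod (Measure.infinitePi fun _ : ι => ν)).map
      (fun w i => (w.1 i, w.2 i)) = Measure.infinitePi fun _ : ι => μ.prod ν := by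
  have hz : Measurable fun (w : (ι → X) × (ι → Y)) i => (w.1 i, w.2 i) :=
    measurable_pi_lambda _ fun i => ((measurable_pi_apply i).comp measurable_fst).prodMk
      ((measurable_pi_apply i).comp measurable_snd)
  have hs : Measurable fun (w : ι → X × Y) => ((fun i => (w i).1, fun i => (w i).2) :
      (ι → X) × (ι → Y)) :=
    (measurable_pi_lambda _ fun i => measurable_fst.comp (measurable_pi_apply i)).prodMk
      (measurable_pi_lambda _ fun i => measurable_snd.comp (measurable_pi_apply i))
  have hX : (Set.univ : Set (ι → X)) ∈ squareCylinders fun _ => {s : Set X | MeasurableSet s} :=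
    ⟨∅, fun _ => Set.univ, by simp, by simp⟩
  have hY : (Set.univ : Set (ι → Y)) ∈ squareCylinders fun _ => {s : Set Y | MeasurableSet s} :=
    ⟨∅, fun _ => Set.univ, by simp, by simp⟩
  have hprod : (Measure.infinitePi fun _ : ι => μ).prod (Measure.infinitePi fun _ : ι => ν) =
      (Measure.infinitePi fun _ : ι => μ.prod ν).map
        fun w => (fun i => (w i).1, fun i => (w i).2) := by
    refine Measure.prod_eq_generateFrom (generateFrom_squareCylinders)
      (generateFrom_squareCylinders) (isPiSystem_squareCylinders
        (fun _ => MeasurableSpace.isPiSystem_measurableSet) fun _ => .univ)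
      (isPiSystem_squareCylinders
        (fun _ => MeasurableSpace.isPiSystem_measurableSet) fun _ => .univ)
      ⟨fun _ => Set.univ, fun _ => hX, by simp, by simp [Set.iUnion_const]⟩
      ⟨fun _ => Set.univ, fun _ => hY, by simp, by simp [Set.iUnion_const]⟩ ?_
    rintro _ ⟨s, A, hA, rfl⟩ _ ⟨t, B, hB, rfl⟩
    have hA' (i : ι) : MeasurableSet (A i) := hA i trivial
    have hB' (i : ι) : MeasurableSet (B i) := hB i trivial
    classical
    rw [Measure.map_apply hs ((MeasurableSet.pi s.countable_toSet fun i _ => hA' i).prod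
      (.pi t.countable_toSet fun i _ => hB' i)), Measure.infinitePi_pi _ fun i _ => hA' i,
      Measure.infinitePi_pi _ fun i _ => hB' i]
    have hset : (fun w : ι → X × Y => ((fun i => (w i).1, fun i => (w i).2) :
        (ι → X) × (ι → Y))) ⁻¹' ((s : Set ι).pi A ×ˢ (t : Set ι).pi B) =
        ((s ∪ t : Finset ι) : Set ι).pi fun i =>
          (if i ∈ s then A i else Set.univ) ×ˢ (if i ∈ t then B i else Set.univ) := by
      ext w
      simp only [Set.mem_preimage, Set.mem_prod, Set.mem_pi, Finset.mem_coe, Finset.mem_union]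
      constructor
      · intro h i _
        constructor
        · split_ifs with hi
          exacts [h.1 i hi, trivial]
        · split_ifs with hi
          exacts [h.2 i hi, trivial]
      · intro h
        exact ⟨fun i hi => by simpa [hi] using (h i (Or.inl hi)).1,
          fun i hi => by simpa [hi] using (h i (Or.inr hi)).2⟩
    rw [hset, Measure.infinitePi_pi _ fun i _ => (MeasurableSet.prod
      (by split_ifs; exacts [hA' i, .univ]) (by split_ifs; exacts [hB' i, .univ]))]
    simp only [Measure.prod_prod, Finset.prod_mul_distrib]
    congr 1
    · rw [← Finset.prod_subset Finset.subset_union_left]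
      · exact Finset.prod_congr rfl fun i hi => by simp [hi]
      · intro i _ hi
        simp [hi]
    · rw [← Finset.prod_subset Finset.subset_union_right]
      · exact Finset.prod_congr rfl fun i hi => by simp [hi]
      · intro i _ hi
        simp [hi]
  rw [hprod, Measure.map_map hz hs]
  exact Measure.map_id

theorem measurable_gapStep :
    Measurable fun w : (ℤ → ℕ) × (ℤ → Bool) => gapStep w.1 w.2 := by
  refine measurable_pi_lambda _ fun i => ?_
  have h (i : ℤ) : Measurable fun w : (ℤ → ℕ) × (ℤ → Bool) => (w.1 i, w.2 i) :=
    ((measurable_pi_apply i).comp measurable_fst).prodMk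
      ((measurable_pi_apply i).comp measurable_snd)
  exact (measurable_of_countable (Function.uncurry nextGap)).comp
    ((h i).prodMk ((measurable_of_countable jump).comp (h (i + 1))))

/-- Independent gaps with the law `gapLaw a z` are invariant under the dynamics, provided that the
flow `q` and the balance relation match the parameters. -/
theorem measurePreserving_gapStep {a z : ℝ} (ha : 0 ≤ a) (ha1 : a ≤ 1) (hz : 0 ≤ z) (hz1 : z < 1)
    (p : I) (hbal : z * (1 - a) = a * (1 - z) * (1 - p)) :
    MeasurePreserving (fun w : (ℤ → ℕ) × (ℤ → Bool) => gapStep w.1 w.2)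
      ((Measure.infinitePi fun _ : ℤ => gapLaw a z).prod (coins p))
      (Measure.infinitePi fun _ : ℤ => gapLaw a z) := by
  have := isProbabilityMeasure_gapLaw ha hz hz1.le
  refine ⟨measurable_gapStep, ?_⟩
  have hq : (p : ℝ) * a ∈ I := unitInterval.mul_mem p.2 ⟨ha, ha1⟩
  have h := map_tandem (f := nextGap) (j := jump) (measurable_of_countable _)
    (measurable_of_countable _) (map_nextGap_jump ha ha1 hz hz1 p ⟨_, hq⟩ rfl hbal)
  rw [← map_pair_infinitePi, Measure.map_map] at h
  · exact h
  · refine measurable_pi_lambda _ fun i => ?_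
    have : Measurable fun ω : ℤ → ℕ × Bool => (ω i, jump (ω (i + 1))) :=
      (measurable_pi_apply i).prodMk
        ((measurable_of_countable jump).comp (measurable_pi_apply (i + 1)))
    exact (measurable_of_countable (Function.uncurry nextGap)).comp this
  · exact measurable_pi_lambda _ fun i => ((measurable_pi_apply i).comp measurable_fst).prodMk
      ((measurable_pi_apply i).comp measurable_snd)

/-! ### Configurations with given gaps -/

/-- For `ω = (n, x)`, the positions of the particles when particle `0` is at `x` and the gap between
the balls `i` and `i + 1` is `v * n i`. At least one of the two sums is empty, according to the
sign of `i`. -/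
noncomputable def position (v r : ℝ) (ω : (ℤ → ℕ) × ℝ) (i : ℤ) : ℝ :=
  ω.2 + ∑ j ∈ Finset.Ico 0 i, (2 * r + v * ω.1 j) - ∑ j ∈ Finset.Ico i 0, (2 * r + v * ω.1 j)

/-- The translate of a doubly infinite sequence by `k`. -/
def shift {X : Type*} (k : ℤ) (x : ℤ → X) (i : ℤ) : X := x (i + k)

/-- Relabelling by `k`. -/
noncomputable def reroot (v r : ℝ) (k : ℤ) (ω : (ℤ → ℕ) × ℝ) : (ℤ → ℕ) × ℝ :=
  (shift k ω.1, position v r ω k)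

/-- The dynamics in terms of the gaps and the position of particle `0`. -/
noncomputable def gapDynamics (v : ℝ) (w : ((ℤ → ℕ) × ℝ) × (ℤ → Bool)) : (ℤ → ℕ) × ℝ :=
  (gapStep w.1.1 w.2, w.1.2 + v * (jump (w.1.1 0, w.2 0)).toNat)

section

variable {v r : ℝ}

@[simp]
theorem position_zero (ω : (ℤ → ℕ) × ℝ) : position v r ω 0 = ω.2 := by simp [position]

theorem position_add_one (ω : (ℤ → ℕ) × ℝ) (i : ℤ) :
    position v r ω (i + 1) = position v r ω i + (2 * r + v * ω.1 i) := by
  unfold position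
  rcases le_or_gt 0 i with h | h
  · have e1 : Finset.Ico 0 (i + 1) = insert i (Finset.Ico 0 i) := by
      ext j; simp; omega
    have e2 : Finset.Ico (i + 1) 0 = ∅ := Finset.Ico_eq_empty (by omega)
    have e3 : Finset.Ico i 0 = ∅ := Finset.Ico_eq_empty (by omega)
    rw [e1, e2, e3, Finset.sum_insert (by simp)]
    ring
  · have e1 : Finset.Ico i 0 = insert i (Finset.Ico (i + 1) 0) := by
      ext j; simp; omega
    have e2 : Finset.Ico 0 (i + 1) = ∅ := Finset.Ico_eq_empty (by omega)
    have e3 : Finset.Ico 0 i = ∅ := Finset.Ico_eq_empty (by omega)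
    rw [e1, e2, e3, Finset.sum_insert (by simp)]
    ring

theorem eq_position {ω : (ℤ → ℕ) × ℝ} {x : ℤ → ℝ} (h0 : x 0 = ω.2)
    (h : ∀ i, x (i + 1) = x i + (2 * r + v * ω.1 i)) (i : ℤ) : x i = position v r ω i := by
  induction i using Int.induction_on with
  | zero => simpa using h0
  | succ i ih => rw [h, position_add_one, ih]
  | pred i ih =>
    have h1 := h (-i - 1)
    have h2 := position_add_one (v := v) (r := r) ω (-i - 1)
    rw [sub_add_cancel] at h1 h2
    linarith

theorem position_reroot (k : ℤ) (ω : (ℤ → ℕ) × ℝ) (i : ℤ) :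
    position v r (reroot v r k ω) i = position v r ω (i + k) := by
  refine (eq_position (x := fun i => position v r ω (i + k)) ?_ (fun i => ?_) i).symm
  · simp [reroot]
  · have := position_add_one (v := v) (r := r) ω (i + k)
    simp only [reroot, shift]
    rw [← this]
    congr 1
    ring

theorem stepFun_position (hv : 0 ≤ v) (ω : (ℤ → ℕ) × ℝ) (ξ : ℤ → Bool) (i : ℤ) :
    stepFun v r (position v r ω) ξ i =
      position v r ω i + v * (jump (ω.1 i, ξ i)).toNat := by
  unfold stepFun
  rw [position_add_one]
  cases hξ : ξ i with
  | false => simp [jump]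
  | true =>
    simp only [if_true, jump, Bool.true_and]
    rcases Nat.eq_zero_or_pos (ω.1 i) with h | h
    · simp [h, hv]
    · have h1 : (1 : ℝ) ≤ ω.1 i := by exact_mod_cast h
      have h2 := mul_le_mul_of_nonneg_left h1 hv
      rw [min_eq_left (by linarith)]
      simp [h.ne']

theorem position_gapDynamics (hv : 0 ≤ v) (ω : (ℤ → ℕ) × ℝ) (ξ : ℤ → Bool) (i : ℤ) :
    position v r (gapDynamics v (ω, ξ)) i = stepFun v r (position v r ω) ξ i := by
  refine (eq_position ?_ (fun i => ?_) i).symm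
  · rw [stepFun_position hv, position_zero]
    rfl
  · rw [stepFun_position hv, stepFun_position hv, position_add_one]
    have hle : (jump (ω.1 i, ξ i)).toNat ≤ ω.1 i := by
      rcases Nat.eq_zero_or_pos (ω.1 i) with h | h
      · simp [jump, h]
      · exact (Bool.toNat_le _).trans h
    simp only [gapDynamics, gapStep, nextGap]
    push_cast [Nat.cast_sub hle]
    ring

theorem monotone_position (hv : 0 ≤ v) (hr : 0 ≤ r) (ω : (ℤ → ℕ) × ℝ) :
    Monotone (position v r ω) := by
  refine monotone_int_of_le_succ fun i => ?_
  rw [position_add_one]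
  have : 0 ≤ 2 * r + v * ω.1 i := by positivity
  linarith

theorem gapDynamics_reroot (hv : 0 ≤ v) (k : ℤ) (ω : (ℤ → ℕ) × ℝ) (ξ : ℤ → Bool) :
    gapDynamics v (reroot v r k ω, shift k ξ) = reroot v r k (gapDynamics v (ω, ξ)) := by
  refine Prod.ext ?_ ?_
  · funext i
    simp only [gapDynamics, reroot, gapStep, shift, add_right_comm]
  · change position v r ω k + _ = position v r (gapDynamics v (ω, ξ)) k
    rw [position_gapDynamics hv, stepFun_position hv]
    simp [reroot, shift]

theorem measurable_position (i : ℤ) : Measurable fun ω => position v r ω i := by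
  unfold position
  have h (j : ℤ) : Measurable fun ω : (ℤ → ℕ) × ℝ => 2 * r + v * (ω.1 j : ℝ) :=
    (((measurable_of_countable (Nat.cast : ℕ → ℝ)).comp
      ((measurable_pi_apply j).comp measurable_fst)).const_mul v).const_add _
  exact (measurable_snd.add (Finset.measurable_sum _ fun j _ => h j)).sub
    (Finset.measurable_sum _ fun j _ => h j)

theorem measurable_gapDynamics : Measurable (gapDynamics v) := by
  have h : Measurable fun w : ((ℤ → ℕ) × ℝ) × (ℤ → Bool) => (w.1.1 0, w.2 0) :=
    ((measurable_pi_apply 0).comp (measurable_fst.comp measurable_fst)).prodMk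
      ((measurable_pi_apply 0).comp measurable_snd)
  have h2 : Measurable fun w : ((ℤ → ℕ) × ℝ) × (ℤ → Bool) =>
      ((jump (w.1.1 0, w.2 0)).toNat : ℝ) :=
    (measurable_of_countable fun w => ((jump w).toNat : ℝ)).comp h
  exact (measurable_gapStep.comp
    ((measurable_fst.comp measurable_fst).prodMk measurable_snd)).prodMk
    ((measurable_snd.comp measurable_fst).add (h2.const_mul v))

theorem measurable_shift {X : Type*} [MeasurableSpace X] (k : ℤ) :
    Measurable (shift (X := X) k) :=
  measurable_pi_lambda _ fun i => measurable_pi_apply (i + k)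

theorem measurableSet_admissible :
    MeasurableSet {ω : (ℤ → ℕ) × ℝ | Admissible r (position v r ω)} := by
  have : {ω : (ℤ → ℕ) × ℝ | Admissible r (position v r ω)} =
      (⋂ i : ℤ, {ω | position v r ω i + r ≤ position v r ω (i + 1) - r}) ∩
      ({ω | Tendsto (fun i => position v r ω i) atTop atTop} ∩
        {ω | Tendsto (fun i => position v r ω i) atBot atBot}) := by
    ext ω
    simp only [Set.mem_inter_iff, Set.mem_iInter]
    exact ⟨fun h => ⟨h.1, h.2, h.3⟩, fun h => ⟨h.1, h.2.1, h.2.2⟩⟩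
  rw [this]
  exact (MeasurableSet.iInter fun i => measurableSet_le ((measurable_position i).add_const r)
    ((measurable_position (i + 1)).sub_const r)).inter
    ((measurableSet_tendsto _ measurable_position).inter
      (measurableSet_tendsto _ measurable_position))

end

/-- Particles at distance `2 * r + 1`. -/
theorem admissible_arithmetic {r : ℝ} (hr : 0 ≤ r) :
    Admissible r fun i : ℤ => (2 * r + 1) * i where
  separated i := by push_cast; linarith
  tendsto_atTop := tendsto_intCast_atTop_atTop.const_mul_atTop (by positivity)
  tendsto_atBot := (tendsto_intCast_atBot_iff.2 tendsto_id).const_mul_atBot (by positivity)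

open scoped Classical in
/-- The labelled configuration with given gaps and given position of particle `0`, and an arbitrary
one for the null set of gaps which do not define a configuration. -/
noncomputable def labelled (v : ℝ) {r : ℝ} (hr : 0 ≤ r) (ω : (ℤ → ℕ) × ℝ) : Labelled r :=
  if h : Admissible r (position v r ω) then ⟨_, h⟩ else ⟨_, admissible_arithmetic hr⟩

section

variable {v r : ℝ}

theorem labelled_of_admissible (hr : 0 ≤ r) {ω : (ℤ → ℕ) × ℝ}
    (h : Admissible r (position v r ω)) : labelled v hr ω = ⟨_, h⟩ := dif_pos h

theorem measurable_labelled (hr : 0 ≤ r) : Measurable (labelled v hr) := by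
  classical
  refine Measurable.subtype_mk (f := fun ω => (labelled v hr ω).1)
    (measurable_pi_lambda _ fun i => ?_)
  have : (fun ω => (labelled v hr ω).1 i) = fun ω =>
      if Admissible r (position v r ω) then position v r ω i else (2 * r + 1) * i := by
    funext ω
    unfold labelled
    split_ifs <;> rfl
  rw [this]
  exact Measurable.ite measurableSet_admissible (measurable_position i) measurable_const

theorem admissible_reroot_iff (k : ℤ) (ω : (ℤ → ℕ) × ℝ) :
    Admissible r (position v r (reroot v r k ω)) ↔ Admissible r (position v r ω) := by
  have key {x y : ℤ → ℝ} {k : ℤ} (h : ∀ i, y i = x (i + k)) (hx : Admissible r x) :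
      Admissible r y := by
    obtain rfl : y = fun i => x (i + k) := funext h
    refine ⟨fun i => ?_, hx.2.comp (tendsto_atTop_add_const_right _ k tendsto_id),
      hx.3.comp (tendsto_atBot_add_const_right _ k tendsto_id)⟩
    have := hx.1 (i + k)
    rwa [add_right_comm] at this
  refine ⟨key (k := -k) fun i => ?_, key (k := k) fun i => position_reroot k ω i⟩
  rw [position_reroot, neg_add_cancel_right]

theorem forget_labelled_reroot (hr : 0 ≤ r) (k : ℤ) (ω : (ℤ → ℕ) × ℝ) :
    forget (labelled v hr (reroot v r k ω)) = forget (labelled v hr ω) := by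
  by_cases h : Admissible r (position v r ω)
  · have h' := (admissible_reroot_iff k ω).2 h
    rw [labelled_of_admissible hr h, labelled_of_admissible hr h']
    refine (Quotient.sound (s := relabel r) ⟨k, fun i => ?_⟩).symm
    exact position_reroot k ω i
  · have h' := fun h1 => h ((admissible_reroot_iff k ω).1 h1)
    unfold labelled
    rw [dif_neg h, dif_neg h']

theorem labelled_gapDynamics (hv : 0 ≤ v) (hr : 0 ≤ r) {ω : (ℤ → ℕ) × ℝ}
    (h : Admissible r (position v r ω)) (ξ : ℤ → Bool) :
    labelled v hr (gapDynamics v (ω, ξ)) = step hv (labelled v hr ω) ξ := by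
  have e : position v r (gapDynamics v (ω, ξ)) = stepFun v r (position v r ω) ξ :=
    funext (position_gapDynamics hv ω ξ)
  have h' : Admissible r (position v r (gapDynamics v (ω, ξ))) := by
    rw [e]
    exact admissible_stepFun hv h ξ
  rw [labelled_of_admissible hr h, labelled_of_admissible hr h']
  exact Subtype.ext e

/-! ### A fundamental domain of relabelling -/

/-- The event that `k` labels the last particle in `(-∞, 0]`. -/
def originCell (v r : ℝ) (k : ℤ) : Set ((ℤ → ℕ) × ℝ) :=
  {ω | position v r ω k ≤ 0 ∧ 0 < position v r ω (k + 1)}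

theorem measurableSet_originCell (k : ℤ) : MeasurableSet (originCell v r k) :=
  (measurableSet_le (measurable_position k) measurable_const).inter
    (measurableSet_lt measurable_const (measurable_position (k + 1)))

theorem pairwise_disjoint_originCell (hv : 0 ≤ v) (hr : 0 ≤ r) :
    Pairwise (Function.onFun Disjoint (originCell v r)) := by
  have key {k l : ℤ} (h : k < l) : Disjoint (originCell v r k) (originCell v r l) := by
    rw [Set.disjoint_left]
    rintro ω ⟨_, h1⟩ ⟨h2, _⟩
    have := monotone_position hv hr ω (show k + 1 ≤ l from h)
    linarith
  intro k l h
  rcases lt_or_gt_of_ne h with h | h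
  exacts [key h, (key h).symm]

theorem exists_mem_originCell {ω : (ℤ → ℕ) × ℝ} (hv : 0 ≤ v) (hr : 0 ≤ r)
    (h : Admissible r (position v r ω)) : ∃ k, ω ∈ originCell v r k := by
  obtain ⟨a, ha⟩ := (h.tendsto_atBot.eventually_le_atBot 0).exists
  obtain ⟨b, hb⟩ := (h.tendsto_atTop.eventually_gt_atTop 0).exists
  obtain ⟨k, hk, hk'⟩ := Int.exists_greatest_of_bdd (P := fun k => position v r ω k ≤ 0)
    ⟨b, fun z hz => le_of_not_gt fun hbz => by
      have := monotone_position hv hr ω hbz.le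
      linarith⟩ ⟨a, ha⟩
  refine ⟨k, hk, lt_of_not_ge fun hn => ?_⟩
  have := hk' _ hn
  omega

theorem reroot_mem_originCell_iff (k l : ℤ) (ω : (ℤ → ℕ) × ℝ) :
    reroot v r k ω ∈ originCell v r l ↔ ω ∈ originCell v r (l + k) := by
  simp only [originCell, Set.mem_ofPred_eq, position_reroot, add_right_comm]

end

/-- An event which is invariant under a family of measure preserving maps indexed by `ℤ` meets any
two fundamental domains in sets of equal measure. -/
theorem measure_inter_fundamentalDomain_eq {W : Type*} [MeasurableSpace W] {μ : Measure W}
    {T : ℤ → W → W} (hT : ∀ k, MeasurePreserving (T k) μ μ) {E F : ℤ → Set W} {A : Set W}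
    (hE : ∀ k, MeasurableSet (E k)) (hF : ∀ k, MeasurableSet (F k)) (hA : MeasurableSet A)
    (hEd : Pairwise (Function.onFun Disjoint E)) (hFd : Pairwise (Function.onFun Disjoint F))
    (hEu : ∀ᵐ w ∂μ, ∃ k, w ∈ E k) (hFu : ∀ᵐ w ∂μ, ∃ k, w ∈ F k)
    (hTE : ∀ k j, T k ⁻¹' E j = E (j + k)) (hTF : ∀ k j, T k ⁻¹' F j = F (j + k))
    (hTA : ∀ k, T k ⁻¹' A = A) : μ (A ∩ E 0) = μ (A ∩ F 0) := by
  have key {B : Set W} {G : ℤ → Set W} (hB : MeasurableSet B) (hG : ∀ k, MeasurableSet (G k))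
      (hGd : Pairwise (Function.onFun Disjoint G)) (hGu : ∀ᵐ w ∂μ, ∃ k, w ∈ G k) :
      μ B = ∑' k, μ (B ∩ G k) := by
    rw [← measure_iUnion]
    · refine measure_congr ?_
      filter_upwards [hGu] with w hw
      refine propext ⟨fun h => ?_, fun h => ?_⟩
      · obtain ⟨k, hk⟩ := hw
        exact Set.mem_iUnion.2 ⟨k, h, hk⟩
      · obtain ⟨k, hk⟩ := Set.mem_iUnion.1 h
        exact hk.1
    · intro k l h
      exact (hGd h).mono Set.inter_subset_right Set.inter_subset_right
    · exact fun k => hB.inter (hG k)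
  rw [key (hA.inter (hE 0)) hF hFd hFu, key (hA.inter (hF 0)) hE hEd hEu,
    ← (Equiv.neg ℤ).tsum_eq]
  refine tsum_congr fun k => ?_
  rw [← (hT k).measure_preimage ((hA.inter (hE 0)).inter (hF _)).nullMeasurableSet]
  simp only [Set.preimage_inter, hTA, hTE, hTF, Equiv.neg_apply, neg_add_cancel, zero_add]
  rw [Set.inter_right_comm]

/-! ### The stationary measure on rooted configurations -/

/-- Independent gaps of law `γ`, and Lebesgue measure for the position of particle `0`. This
infinite measure is invariant both under the dynamics and under relabelling. -/
noncomputable def rootedMeasure (γ : Measure ℕ) : Measure ((ℤ → ℕ) × ℝ) :=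
  (Measure.infinitePi fun _ : ℤ => γ).prod volume

section

variable {v r : ℝ} {γ : Measure ℕ} [IsProbabilityMeasure γ]

instance : SFinite (rootedMeasure γ) := by
  unfold rootedMeasure
  infer_instance

theorem measurePreserving_shift {X : Type*} [MeasurableSpace X] (μ : Measure X)
    [IsProbabilityMeasure μ] (k : ℤ) :
    MeasurePreserving (shift k) (Measure.infinitePi fun _ : ℤ => μ)
      (Measure.infinitePi fun _ : ℤ => μ) := by
  refine ⟨measurable_shift k, ?_⟩
  have h := Measure.infinitePi_map_piCongrLeft (μ := fun _ : ℤ => μ) (Equiv.subRight k)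
  have e : shift (X := X) k = MeasurableEquiv.piCongrLeft (fun _ => X) (Equiv.subRight k) := by
    funext ξ i
    have h2 := Equiv.piCongrLeft_apply_apply (fun _ : ℤ => X) (Equiv.subRight k) ξ (i + k)
    simp only [Equiv.subRight_apply, add_sub_cancel_right] at h2
    exact h2.symm
  rw [e]
  exact h

theorem measurePreserving_reroot (k : ℤ) :
    MeasurePreserving (reroot v r k) (rootedMeasure γ) (rootedMeasure γ) := by
  refine (measurePreserving_shift γ k).skew_product (g := fun n x => position v r (n, x) k)
    (measurable_position k) (Eventually.of_forall fun n => ?_)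
  have : (fun x : ℝ => position v r (n, x) k) = fun x => x + position v r (n, 0) k := by
    funext x
    simp only [position]
    ring
  rw [this]
  exact (measurePreserving_add_right volume _).map_eq

theorem measurePreserving_gapDynamics {p : I}
    (h : MeasurePreserving (fun w : (ℤ → ℕ) × (ℤ → Bool) => gapStep w.1 w.2)
      ((Measure.infinitePi fun _ : ℤ => γ).prod (coins p)) (Measure.infinitePi fun _ : ℤ => γ)) :
    MeasurePreserving (gapDynamics v) ((rootedMeasure γ).prod (coins p)) (rootedMeasure γ) := by
  have hj : Measurable fun q : ((ℤ → ℕ) × (ℤ → Bool)) × ℝ =>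
      q.2 + v * (jump (q.1.1 0, q.1.2 0)).toNat := by
    have h : Measurable fun w : ((ℤ → ℕ) × (ℤ → Bool)) × ℝ => (w.1.1 0, w.1.2 0) :=
      ((measurable_pi_apply 0).comp (measurable_fst.comp measurable_fst)).prodMk
        ((measurable_pi_apply 0).comp (measurable_snd.comp measurable_fst))
    have h2 : Measurable fun w : ((ℤ → ℕ) × (ℤ → Bool)) × ℝ =>
        ((jump (w.1.1 0, w.1.2 0)).toNat : ℝ) :=
      (measurable_of_countable fun w => ((jump w).toNat : ℝ)).comp h
    exact measurable_snd.add (h2.const_mul v)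
  have h1 := h.skew_product (μc := (volume : Measure ℝ)) (μd := volume)
    (g := fun q x => x + v * (jump (q.1 0, q.2 0)).toNat) hj
    (Eventually.of_forall fun q => (measurePreserving_add_right volume _).map_eq)
  have h2 := measurePreserving_prodAssoc (Measure.infinitePi fun _ : ℤ => γ)
    (volume : Measure ℝ) (coins p)
  have h3 := (MeasurePreserving.id (Measure.infinitePi fun _ : ℤ => γ)).prod
    (Measure.measurePreserving_swap (μ := (volume : Measure ℝ)) (ν := coins p))
  have h4 := (measurePreserving_prodAssoc (Measure.infinitePi fun _ : ℤ => γ)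
    (coins p) (volume : Measure ℝ)).symm
  exact h1.comp (h4.comp (h3.comp h2))

/-- The strong law of large numbers for the positions. -/
theorem ae_tendsto_position_div {m : ℝ} (hm : 0 ≤ m)
    (hγ : ∫⁻ n, ENNReal.ofReal n ∂γ = ENNReal.ofReal m) :
    ∀ᵐ n ∂(Measure.infinitePi fun _ : ℤ => γ), ∀ x : ℝ,
      Tendsto (fun N : ℕ => position v r (n, x) N / N) atTop (𝓝 (2 * r + v * m)) ∧
      Tendsto (fun N : ℕ => -position v r (n, x) (-N) / N) atTop (𝓝 (2 * r + v * m)) := by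
  set Q := Measure.infinitePi fun _ : ℤ => γ with hQ
  have hmeas : Measurable (Nat.cast : ℕ → ℝ) := measurable_of_countable _
  have hint : Integrable (Nat.cast : ℕ → ℝ) γ := by
    refine ⟨hmeas.aestronglyMeasurable, ?_⟩
    rw [hasFiniteIntegral_iff_ofReal (Eventually.of_forall fun n => Nat.cast_nonneg n), hγ]
    exact ENNReal.ofReal_lt_top
  have hmean : ∫ n, (n : ℝ) ∂γ = m := by
    rw [integral_eq_lintegral_of_nonneg_ae (Eventually.of_forall fun n => Nat.cast_nonneg n)
      hmeas.aestronglyMeasurable, hγ, ENNReal.toReal_ofReal hm]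
  have hindep : iIndepFun (fun (i : ℤ) (n : ℤ → ℕ) => (n i : ℝ)) Q :=
    iIndepFun_infinitePi (X := fun _ (k : ℕ) => (k : ℝ)) fun _ => hmeas
  have hpres (i : ℤ) := measurePreserving_eval_infinitePi (fun _ : ℤ => γ) i
  have hid (i j : ℤ) : IdentDistrib (fun n : ℤ → ℕ => (n i : ℝ)) (fun n => (n j : ℝ)) Q Q := by
    have h : IdentDistrib (Function.eval i : (ℤ → ℕ) → ℕ) (Function.eval j) Q Q :=
      ⟨(hpres i).measurable.aemeasurable, (hpres j).measurable.aemeasurable,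
        by rw [(hpres i).map_eq, (hpres j).map_eq]⟩
    exact h.comp hmeas
  have hint' (i : ℤ) : Integrable (fun n : ℤ → ℕ => (n i : ℝ)) Q :=
    (hpres i).integrable_comp_of_integrable hint
  have hmean' (i : ℤ) : ∫ n, (n i : ℝ) ∂Q = m := by
    rw [← hmean, ← (hpres i).map_eq]
    exact (integral_map (hpres i).measurable.aemeasurable hmeas.aestronglyMeasurable).symm
  have hlln (e : ℕ → ℤ) (he : Function.Injective e) : ∀ᵐ n ∂Q,
      Tendsto (fun N : ℕ => (∑ i ∈ Finset.range N, (n (e i) : ℝ)) / N) atTop (𝓝 m) := by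
    have := strong_law_ae_real (fun i (n : ℤ → ℕ) => (n (e i) : ℝ)) (hint' (e 0))
      (fun i j hij => hindep.indepFun (he.ne hij)) (fun i => hid _ _)
    rwa [hmean'] at this
  have hlim (f : ℕ → ℝ) (x : ℝ)
      (hf : Tendsto (fun N : ℕ => (∑ i ∈ Finset.range N, f i) / N) atTop (𝓝 m)) :
      Tendsto (fun N : ℕ => (x + ∑ i ∈ Finset.range N, (2 * r + v * f i)) / N) atTop
        (𝓝 (2 * r + v * m)) := by
    have h0 : Tendsto (fun N : ℕ => x / (N : ℝ)) atTop (𝓝 0) :=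
      tendsto_const_div_atTop_nhds_zero_nat x
    have h1 := (h0.add_const (2 * r)).add (hf.const_mul v)
    rw [zero_add] at h1
    refine h1.congr' ?_
    filter_upwards [eventually_gt_atTop 0] with N hN
    have : (N : ℝ) ≠ 0 := by positivity
    rw [Finset.sum_add_distrib, ← Finset.mul_sum _ f v]
    simp only [Finset.sum_const, Finset.card_range, nsmul_eq_mul]
    field_simp
    ring
  filter_upwards [hlln (fun i => i) Nat.cast_injective,
    hlln (fun i => -(i : ℤ) - 1) fun i j h => by simpa using h] with n hn1 hn2 x
  have hp1 (N : ℕ) : position v r (n, x) N =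
      x + ∑ i ∈ Finset.range N, (2 * r + v * n i) := by
    induction N with
    | zero => simp
    | succ N ih =>
      rw [Finset.sum_range_succ, Nat.cast_succ, position_add_one, ih]
      ring
  have hp2 (N : ℕ) : -position v r (n, x) (-N) =
      -x + ∑ i ∈ Finset.range N, (2 * r + v * n (-(i : ℤ) - 1)) := by
    induction N with
    | zero => simp
    | succ N ih =>
      have := position_add_one (v := v) (r := r) (n, x) (-N - 1)
      rw [sub_add_cancel] at this
      rw [Finset.sum_range_succ, ← add_assoc, ← ih, this, Nat.cast_succ, neg_add, ← sub_eq_add_neg]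
      ring
  simp only [hp1, hp2]
  exact ⟨hlim _ _ hn1, hlim _ _ hn2⟩

theorem admissible_position (hv : 0 ≤ v) (hr : 0 ≤ r) {ω : (ℤ → ℕ) × ℝ} {d : ℝ} (hd : 0 < d)
    (h1 : Tendsto (fun N : ℕ => position v r ω N / N) atTop (𝓝 d))
    (h2 : Tendsto (fun N : ℕ => -position v r ω (-N) / N) atTop (𝓝 d)) :
    Admissible r (position v r ω) := by
  have key {f : ℕ → ℝ} (hf : Tendsto (fun N : ℕ => f N / N) atTop (𝓝 d)) :
      Tendsto f atTop atTop := by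
    refine (hf.pos_mul_atTop hd tendsto_natCast_atTop_atTop).congr' ?_
    filter_upwards [eventually_gt_atTop 0] with N hN
    have : (N : ℝ) ≠ 0 := by positivity
    field_simp
  refine ⟨fun i => ?_, ?_, ?_⟩
  · rw [position_add_one]
    have : 0 ≤ v * ω.1 i := by positivity
    linarith
  · refine tendsto_atTop_atTop_of_monotone (monotone_position hv hr ω) fun b => ?_
    obtain ⟨N, hN⟩ := ((key h1).eventually_ge_atTop b).exists
    exact ⟨N, hN⟩
  · refine tendsto_atBot_atBot_of_monotone (monotone_position hv hr ω) fun b => ?_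
    obtain ⟨N, hN⟩ := ((key h2).eventually_ge_atTop (-b)).exists
    exact ⟨-N, by linarith⟩

/-- The density does not depend on the particle from which one starts to count. -/
theorem tendsto_density {x : ℤ → ℝ} {d : ℝ} (hd : 0 < d)
    (h : Tendsto (fun N : ℕ => x N / N) atTop (𝓝 d)) (k : ℤ) :
    Tendsto (fun n : ℕ => (n : ℝ) / (x ((n : ℤ) - 1 + k) - x k)) atTop (𝓝 d⁻¹) := by
  have hφ : Tendsto (fun n : ℕ => ((n : ℤ) - 1 + k).toNat) atTop atTop := by
    refine tendsto_atTop_atTop.2 fun b => ⟨b + (1 - k).toNat, fun n hn => ?_⟩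
    omega
  have h1 := h.comp hφ
  have h2 : Tendsto (fun n : ℕ => 1 + ((k : ℝ) - 1) / n) atTop (𝓝 1) := by
    simpa using (tendsto_const_div_atTop_nhds_zero_nat ((k : ℝ) - 1)).const_add 1
  have h3 : Tendsto (fun n : ℕ => x k / (n : ℝ)) atTop (𝓝 0) :=
    tendsto_const_div_atTop_nhds_zero_nat (x k)
  have h4 := ((h1.mul h2).sub h3).inv₀ (by simpa using hd.ne')
  rw [mul_one, sub_zero] at h4
  refine h4.congr' ?_
  filter_upwards [eventually_gt_atTop ((1 - k).toNat + 1)] with n hn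
  have hn0 : (n : ℝ) ≠ 0 := by
    have : 0 < n := by omega
    positivity
  have he : ((((n : ℤ) - 1 + k).toNat : ℕ) : ℤ) = (n : ℤ) - 1 + k := by omega
  have he' : ((((n : ℤ) - 1 + k).toNat : ℕ) : ℝ) = (n : ℝ) - 1 + k := by exact_mod_cast he
  have hpos : (n : ℝ) - 1 + k ≠ 0 := by
    have : (0 : ℤ) < (n : ℤ) - 1 + k := by omega
    have : (0 : ℝ) < (n : ℝ) - 1 + k := by exact_mod_cast this
    exact this.ne'
  simp only [Function.comp_apply, he, he']
  have e1 : 1 + ((k : ℝ) - 1) / n = ((n : ℝ) - 1 + k) / n := by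
    field_simp
    ring
  rw [e1, div_mul_div_cancel₀ hpos, ← sub_div, inv_div]

theorem ae_rootedMeasure_tendsto {m : ℝ} (hm : 0 ≤ m)
    (hγ : ∫⁻ n, ENNReal.ofReal n ∂γ = ENNReal.ofReal m) :
    ∀ᵐ ω ∂rootedMeasure γ,
      Tendsto (fun N : ℕ => position v r ω N / N) atTop (𝓝 (2 * r + v * m)) ∧
      Tendsto (fun N : ℕ => -position v r ω (-N) / N) atTop (𝓝 (2 * r + v * m)) := by
  have h := (Measure.quasiMeasurePreserving_fst (μ := Measure.infinitePi fun _ : ℤ => γ)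
    (ν := (volume : Measure ℝ))).ae (ae_tendsto_position_div (v := v) (r := r) hm hγ)
  filter_upwards [h] with ω hω
  exact hω ω.2

theorem rootedMeasure_originCell (hv : 0 ≤ v) (hr : 0 ≤ r) {m : ℝ}
    (hγ : ∫⁻ n, ENNReal.ofReal n ∂γ = ENNReal.ofReal m) :
    rootedMeasure γ (originCell v r 0) =
      ENNReal.ofReal (2 * r) + ENNReal.ofReal v * ENNReal.ofReal m := by
  have hset (n : ℤ → ℕ) : Prod.mk n ⁻¹' originCell v r 0 = Set.Ioc (-(2 * r + v * n 0)) 0 := by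
    ext x
    simp only [originCell, Set.mem_preimage, Set.mem_ofPred_eq, position_zero, position_add_one,
      Set.mem_Ioc]
    constructor
    · rintro ⟨h1, h2⟩
      exact ⟨by linarith, h1⟩
    · rintro ⟨h1, h2⟩
      exact ⟨h2, by linarith⟩
  have hmeas : Measurable fun k : ℕ =>
      ENNReal.ofReal (2 * r) + ENNReal.ofReal v * ENNReal.ofReal k :=
    measurable_of_countable _
  rw [rootedMeasure, Measure.prod_apply (measurableSet_originCell 0)]
  simp only [hset, Real.volume_Ioc]
  have hpt (n : ℤ → ℕ) : ENNReal.ofReal (0 - -(2 * r + v * n 0)) =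
      ENNReal.ofReal (2 * r) + ENNReal.ofReal v * ENNReal.ofReal (n 0) := by
    rw [← ENNReal.ofReal_mul hv, ← ENNReal.ofReal_add (by positivity) (by positivity)]
    congr 1
    ring
  simp only [hpt]
  refine ((measurePreserving_eval_infinitePi (fun _ : ℤ => γ) 0).lintegral_comp hmeas).trans ?_
  rw [lintegral_add_left measurable_const, lintegral_const, measure_univ, mul_one,
    lintegral_const_mul _ (measurable_of_countable _), hγ]

end

/-! ### The stationary measure on configurations -/

/-- The law of the configuration under the rooted measure, restricted to the fundamental domain of
relabelling in which particle `0` is the last one in `(-∞, 0]`. It has total mass equal to the mean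
distance of neighbours. -/
noncomputable def configurationMeasure (v : ℝ) {r : ℝ} (hr : 0 ≤ r) (γ : Measure ℕ) :
    Measure (Configuration r) :=
  ((rootedMeasure γ).restrict (originCell v r 0)).map fun ω => forget (labelled v hr ω)

section

variable {v r : ℝ}

theorem measurable_forget_labelled (hr : 0 ≤ r) :
    Measurable fun ω => forget (labelled v hr ω) :=
  measurable_forget.comp (measurable_labelled hr)

theorem configurationMeasure_apply {γ : Measure ℕ} (hr : 0 ≤ r) {B : Set (Configuration r)}
    (hB : MeasurableSet B) : configurationMeasure v hr γ B =
      rootedMeasure γ ((fun ω => forget (labelled v hr ω)) ⁻¹' B ∩ originCell v r 0) := by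
  have hm := measurable_forget_labelled (v := v) hr hB
  rw [configurationMeasure, Measure.map_apply (measurable_forget_labelled hr) hB,
    Measure.restrict_apply hm]

/-- If the gaps are invariant under their dynamics, then the law of the configuration is invariant.
The events that particle `0` is the last one in `(-∞, 0]` before, respectively after, a step are
both fundamental domains of relabelling. -/
theorem invariant_configurationMeasure {γ : Measure ℕ} [IsProbabilityMeasure γ]
    (hv : 0 ≤ v) (hr : 0 ≤ r) {p : I}
    (h : MeasurePreserving (fun w : (ℤ → ℕ) × (ℤ → Bool) => gapStep w.1 w.2)
      ((Measure.infinitePi fun _ : ℤ => γ).prod (coins p)) (Measure.infinitePi fun _ : ℤ => γ))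
    (hadm : ∀ᵐ ω ∂rootedMeasure γ, Admissible r (position v r ω)) :
    (process p hv r).Invariant (configurationMeasure v hr γ) := by
  have hΦ := measurePreserving_gapDynamics (v := v) h
  have hconf := measurable_forget_labelled (v := v) hr
  ext B hB
  rw [Measure.bind_apply hB (process p hv r).measurable.aemeasurable]
  have hlint : ∫⁻ c, process p hv r c B ∂configurationMeasure v hr γ =
      ∫⁻ ω in originCell v r 0, stepLaw p hv (labelled v hr ω) B ∂rootedMeasure γ :=
    lintegral_map ((process p hv r).measurable_coe hB) hconf
  rw [hlint]
  set A : Set (((ℤ → ℕ) × ℝ) × (ℤ → Bool)) :=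
    {w | forget (labelled v hr (gapDynamics v w)) ∈ B} with hA
  have hAm : MeasurableSet A := hconf.comp measurable_gapDynamics hB
  have hleft : ∫⁻ ω in originCell v r 0, stepLaw p hv (labelled v hr ω) B ∂rootedMeasure γ =
      ((rootedMeasure γ).prod (coins p)) (A ∩ Prod.fst ⁻¹' originCell v r 0) := by
    have e : A ∩ Prod.fst ⁻¹' originCell v r 0 = A ∩ (originCell v r 0 ×ˢ Set.univ) := by
      rw [Set.prod_univ]
    rw [e, ← Measure.restrict_apply hAm, ← Measure.prod_restrict, Measure.restrict_univ,
      Measure.prod_apply hAm]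
    refine lintegral_congr_ae ?_
    filter_upwards [ae_restrict_of_ae hadm] with ω hω
    have hstep : Measurable fun ξ => forget (step hv (labelled v hr ω) ξ) :=
      measurable_forget.comp ((measurable_step hv).comp measurable_prodMk_left)
    rw [stepLaw, Measure.map_apply hstep hB]
    congr 1
    ext ξ
    simp only [hA, Set.mem_preimage, Set.mem_ofPred_eq, labelled_gapDynamics hv hr hω]
  have hright : configurationMeasure v hr γ B =
      ((rootedMeasure γ).prod (coins p)) (A ∩ gapDynamics v ⁻¹' originCell v r 0) := by
    rw [configurationMeasure_apply hr hB,
      ← hΦ.measure_preimage ((hconf hB).inter (measurableSet_originCell 0)).nullMeasurableSet]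
    rfl
  rw [hleft, hright]
  have hcell {ω : (ℤ → ℕ) × ℝ} (hω : Admissible r (position v r ω)) :=
    exists_mem_originCell hv hr hω
  refine measure_inter_fundamentalDomain_eq
    (T := fun k => Prod.map (reroot v r k) (shift k))
    (E := fun k => Prod.fst ⁻¹' originCell v r k)
    (F := fun k => gapDynamics v ⁻¹' originCell v r k)
    (fun k => (measurePreserving_reroot k).prod (measurePreserving_shift _ k))
    (fun k => measurable_fst (measurableSet_originCell k))
    (fun k => measurable_gapDynamics (measurableSet_originCell k)) hAm
    (fun k l hkl => (pairwise_disjoint_originCell hv hr hkl).preimage _)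
    (fun k l hkl => (pairwise_disjoint_originCell hv hr hkl).preimage _)
    ?_ ?_ ?_ ?_ ?_
  · filter_upwards [Measure.quasiMeasurePreserving_fst.ae hadm] with w hw
    exact hcell hw
  · filter_upwards [hΦ.quasiMeasurePreserving.ae hadm] with w hw
    exact hcell hw
  · intro k j
    ext w
    exact reroot_mem_originCell_iff k j w.1
  · intro k j
    ext w
    change gapDynamics v (reroot v r k w.1, shift k w.2) ∈ originCell v r j ↔ _
    rw [gapDynamics_reroot hv]
    exact reroot_mem_originCell_iff k j _
  · intro k
    ext w
    change forget (labelled v hr (gapDynamics v (reroot v r k w.1, shift k w.2))) ∈ B ↔ _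
    rw [gapDynamics_reroot hv, forget_labelled_reroot]
    rfl

/-- A configuration has countably many labellings, and each of them prescribes the position of
particle `0`, which has a continuous law. -/
theorem configurationMeasure_singleton {γ : Measure ℕ} [IsProbabilityMeasure γ] (hr : 0 ≤ r)
    (hadm : ∀ᵐ ω ∂rootedMeasure γ, Admissible r (position v r ω)) (c : Configuration r) :
    configurationMeasure v hr γ {c} = 0 := by
  obtain ⟨y, rfl⟩ : ∃ y : Labelled r, forget y = c := Quotient.exists_rep c
  have hrel {x : Labelled r} (h : forget x = forget y) : ∃ k : ℤ, ∀ i, x.1 i = y.1 (i + k) :=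
    Quotient.exact (s := relabel r) h.symm
  have hm : MeasurableSet {forget y} := by
    have : (forget (r := r) ⁻¹' {forget y}).Countable := by
      have hsub : forget (r := r) ⁻¹' {forget y} ⊆
          ⋃ k : ℤ, {x | x.1 = fun i => y.1 (i + k)} := by
        intro x hx
        obtain ⟨k, hk⟩ := hrel hx
        exact Set.mem_iUnion.2 ⟨k, funext hk⟩
      refine (Set.countable_iUnion fun k => ?_).mono hsub
      exact Set.Subsingleton.countable fun x hx y hy => Subtype.ext (hx.trans hy.symm)
    exact measurableSet_quotient.2 this.measurableSet
  rw [configurationMeasure_apply hr hm]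
  refine measure_mono_null Set.inter_subset_left ?_
  have hnull : ∀ᵐ ω ∂rootedMeasure γ, ∀ k : ℤ, ω.2 ≠ y.1 k := by
    rw [ae_all_iff]
    intro k
    exact Measure.quasiMeasurePreserving_snd.ae
      (measure_eq_zero_iff_ae_notMem.1 (measure_singleton (y.1 k)))
  rw [measure_eq_zero_iff_ae_notMem]
  filter_upwards [hadm, hnull] with ω hω h0 hmem
  have hmem' : forget (labelled v hr ω) = forget y := hmem
  rw [labelled_of_admissible hr hω] at hmem'
  obtain ⟨k, hk⟩ := hrel hmem'
  refine h0 k ?_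
  have := hk 0
  rw [zero_add] at this
  rw [← this]
  exact (position_zero ω).symm

theorem hasDensity_forget_iff (x : Labelled r) (ρ : ℝ) :
    HasDensity (forget x) ρ ↔ ∀ k : ℤ,
      Tendsto (fun n : ℕ => (n : ℝ) / (x.1 ((n : ℤ) - 1 + k) - x.1 k)) atTop (𝓝 ρ) := by
  constructor
  · intro h k
    have hadm : Admissible r fun i => x.1 (i + k) := by
      refine ⟨fun i => ?_, x.2.2.comp (tendsto_atTop_add_const_right _ k tendsto_id),
        x.2.3.comp (tendsto_atBot_add_const_right _ k tendsto_id)⟩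
      have := x.2.1 (i + k)
      rwa [add_right_comm] at this
    have := h ⟨_, hadm⟩ (Quotient.sound (s := relabel r) ⟨k, fun i => rfl⟩ :
      forget x = forget ⟨_, hadm⟩).symm
    simpa using this
  · intro h y hy
    obtain ⟨k, hk⟩ := Quotient.exact (s := relabel r) hy.symm
    simpa [hk] using h k

theorem ae_hasDensity {γ : Measure ℕ} (hr : 0 ≤ r) {d : ℝ} (hd : 0 < d)
    (hadm : ∀ᵐ ω ∂rootedMeasure γ, Admissible r (position v r ω))
    (h : ∀ᵐ ω ∂rootedMeasure γ, Tendsto (fun N : ℕ => position v r ω N / N) atTop (𝓝 d)) :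
    ∀ᵐ c ∂configurationMeasure v hr γ, HasDensity c d⁻¹ := by
  have hm : MeasurableSet {c : Configuration r | HasDensity c d⁻¹} := by
    refine measurableSet_quotient.2 ?_
    change MeasurableSet {x : Labelled r | HasDensity (forget x) d⁻¹}
    simp only [hasDensity_forget_iff, Set.ofPred_forall]
    have hx (i : ℤ) : Measurable fun x : Labelled r => x.1 i :=
      (measurable_pi_apply i).comp measurable_subtype_coe
    exact MeasurableSet.iInter fun k => measurableSet_tendsto _ fun n =>
      measurable_const.div ((hx _).sub (hx k))
  rw [configurationMeasure, ae_map_iff (measurable_forget_labelled hr).aemeasurable hm]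
  filter_upwards [ae_restrict_of_ae hadm, ae_restrict_of_ae h] with ω hω hlim
  rw [labelled_of_admissible hr hω, hasDensity_forget_iff]
  exact tendsto_density hd hlim

end

/-! ### Dependence on the parameters -/

theorem measure_le_liminf_of_ae_eventually_mem {W : Type*} [MeasurableSpace W] {μ : Measure W}
    {S : Set W} {T : ℕ → Set W} (hS : MeasurableSet S) (hT : ∀ k, MeasurableSet (T k))
    (h : ∀ᵐ w ∂μ, w ∈ S → ∀ᶠ k in atTop, w ∈ T k) :
    μ S ≤ liminf (fun k => μ (T k)) atTop := by
  have h1 := lintegral_liminf_le (μ := μ) (u := atTop) (f := fun k => (T k).indicator 1)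
    fun k => measurable_one.indicator (hT k)
  simp only [lintegral_indicator_one (hT _)] at h1
  rw [← lintegral_indicator_one hS]
  refine (lintegral_mono_ae ?_).trans h1
  filter_upwards [h] with w hw
  by_cases hwS : w ∈ S
  · refine le_liminf_of_le (by isBoundedDefault) ?_
    filter_upwards [hw hwS] with k hk
    simp [hwS, hk]
  · simp [hwS]

/-- Couplings: if random gaps converge almost surely, each of them being eventually constant, then
the laws of the configurations converge on open sets. As the total masses agree, no uniform
integrability of the distance of neighbours is needed. -/
theorem configurationMeasure_le_liminf {U : Type*} [MeasurableSpace U] {P : Measure U}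
    [IsProbabilityMeasure P] {v r : ℝ} (hr : 0 ≤ r) {f : U → ℕ} {g : ℕ → U → ℕ}
    (hf : Measurable f) (hg : ∀ k, Measurable (g k))
    (hfg : ∀ᵐ u ∂P, ∀ᶠ k in atTop, g k u = f u)
    (hfa : ∀ᵐ ω ∂rootedMeasure (P.map f), Admissible r (position v r ω))
    (hga : ∀ k, ∀ᵐ ω ∂rootedMeasure (P.map (g k)), Admissible r (position v r ω))
    {B : Set (Configuration r)} (hB : IsOpen B) :
    configurationMeasure v hr (P.map f) B ≤
      liminf (fun k => configurationMeasure v hr (P.map (g k)) B) atTop := by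
  have hconf := measurable_forget_labelled (v := v) hr
  have hcouple {e : U → ℕ} (he : Measurable e) :
      MeasurePreserving (fun w : (ℤ → U) × ℝ => ((fun i => e (w.1 i), w.2) : (ℤ → ℕ) × ℝ))
        ((Measure.infinitePi fun _ : ℤ => P).prod volume) (rootedMeasure (P.map e)) := by
    have : MeasurePreserving (fun (w : ℤ → U) i => e (w i)) (Measure.infinitePi fun _ : ℤ => P)
        (Measure.infinitePi fun _ : ℤ => P.map e) :=
      ⟨measurable_pi_lambda _ fun i => he.comp (measurable_pi_apply i),
        Measure.infinitePi_map_pi _ fun _ => he⟩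
    have hp : IsProbabilityMeasure (P.map e) := Measure.isProbabilityMeasure_map he.aemeasurable
    exact this.prod (MeasurePreserving.id volume)
  have hset : MeasurableSet ((fun ω => forget (labelled v hr ω)) ⁻¹' B ∩ originCell v r 0) :=
    (hconf hB.measurableSet).inter (measurableSet_originCell 0)
  have happ {e : U → ℕ} (he : Measurable e) : configurationMeasure v hr (P.map e) B =
      ((Measure.infinitePi fun _ : ℤ => P).prod volume)
        ((fun w : (ℤ → U) × ℝ => ((fun i => e (w.1 i), w.2) : (ℤ → ℕ) × ℝ)) ⁻¹'
          ((fun ω => forget (labelled v hr ω)) ⁻¹' B ∩ originCell v r 0)) := by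
    have hp : IsProbabilityMeasure (P.map e) := Measure.isProbabilityMeasure_map he.aemeasurable
    rw [configurationMeasure_apply hr hB.measurableSet,
      (hcouple he).measure_preimage hset.nullMeasurableSet]
  simp only [happ hf, happ (hg _)]
  refine measure_le_liminf_of_ae_eventually_mem ((hcouple hf).measurable hset)
    (fun k => (hcouple (hg k)).measurable hset) ?_
  have hev : ∀ᵐ w : (ℤ → U) × ℝ ∂((Measure.infinitePi fun _ : ℤ => P).prod volume),
      ∀ i : ℤ, ∀ᶠ k in atTop, g k (w.1 i) = f (w.1 i) := by
    rw [ae_all_iff]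
    intro i
    exact ((measurePreserving_eval_infinitePi (fun _ : ℤ => P) i).quasiMeasurePreserving.comp
      Measure.quasiMeasurePreserving_fst).ae hfg
  filter_upwards [hev, (hcouple hf).quasiMeasurePreserving.ae hfa,
    ae_all_iff.2 fun k => (hcouple (hg k)).quasiMeasurePreserving.ae (hga k)]
    with w hw hwf hwg ⟨hwB, hwcell⟩
  have hpos (i : ℤ) : ∀ᶠ k in atTop, position v r ((fun i => g k (w.1 i)), w.2) i =
      position v r ((fun i => f (w.1 i)), w.2) i := by
    have h1 : ∀ᶠ k in atTop, ∀ j ∈ Finset.Ico 0 i ∪ Finset.Ico i 0,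
        g k (w.1 j) = f (w.1 j) :=
      (Filter.eventually_all_finset _).2 fun j _ => hw j
    filter_upwards [h1] with k hk
    simp only [position]
    congr 1
    · congr 1
      exact Finset.sum_congr rfl fun j hj => by rw [hk j (Finset.mem_union_left _ hj)]
    · exact Finset.sum_congr rfl fun j hj => by rw [hk j (Finset.mem_union_right _ hj)]
  have hlab : Tendsto (fun k => labelled v hr ((fun i => g k (w.1 i)), w.2)) atTop
      (𝓝 (labelled v hr ((fun i => f (w.1 i)), w.2))) := by
    simp only [labelled_of_admissible hr hwf, labelled_of_admissible hr (hwg _)]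
    rw [tendsto_subtype_rng, tendsto_pi_nhds]
    exact fun i => tendsto_const_nhds.congr' ((hpos i).mono fun k hk => hk.symm)
  filter_upwards [((continuous_forget.tendsto _).comp hlab).eventually (hB.mem_nhds hwB),
    hpos 0, hpos (0 + 1)] with k hkB hk0 hk1
  refine ⟨hkB, ?_⟩
  change position v r _ 0 ≤ 0 ∧ 0 < position v r _ (0 + 1)
  rw [hk0, hk1]
  exact hwcell

/-! ### Parameters for a given mean gap -/

/-- The success probability `1 - z` of the geometric law of a nonzero gap, when gaps have mean `m`
and particles move with probability `p`: the smallest root `s` of `p * m * s² - (1 + m) * s + 1`,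
written without division by `p` or `m`. A gap is then nonzero with probability `m * s`. -/
noncomputable def gapRate (m p : ℝ) : ℝ := 2 / (1 + m + √((1 + m) ^ 2 - 4 * (m * p)))

section

variable {m p : ℝ}

theorem abs_one_sub_le_sqrt (hm : 0 ≤ m) (hp : p ≤ 1) :
    |1 - m| ≤ √((1 + m) ^ 2 - 4 * (m * p)) := by
  refine Real.abs_le_sqrt ?_
  nlinarith [mul_le_mul_of_nonneg_left hp hm]

theorem gapRate_pos (hm : 0 ≤ m) : 0 < gapRate m p := by
  unfold gapRate
  positivity

theorem gapRate_le_one (hm : 0 ≤ m) (hp : p ≤ 1) : gapRate m p ≤ 1 := by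
  have := (le_abs_self _).trans (abs_one_sub_le_sqrt hm hp)
  unfold gapRate
  rw [div_le_one (by positivity)]
  linarith

theorem mul_gapRate_le_one (hm : 0 ≤ m) (hp : p ≤ 1) : m * gapRate m p ≤ 1 := by
  have := (neg_abs_le _).trans' (neg_le_neg (abs_one_sub_le_sqrt hm hp))
  unfold gapRate
  rw [← mul_div_assoc, div_le_one (by positivity)]
  linarith

theorem gapRate_balance (hm : 0 ≤ m) (hp : p ≤ 1) :
    (1 - gapRate m p) * (1 - m * gapRate m p) =
      m * gapRate m p * (1 - (1 - gapRate m p)) * (1 - p) := by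
  have hD : 0 ≤ (1 + m) ^ 2 - 4 * (m * p) := by
    nlinarith [mul_le_mul_of_nonneg_left hp hm, sq_nonneg (1 - m)]
  have hs := Real.sq_sqrt hD
  have h0 := Real.sqrt_nonneg ((1 + m) ^ 2 - 4 * (m * p))
  unfold gapRate
  set s := √((1 + m) ^ 2 - 4 * (m * p))
  have hpos : 1 + m + s ≠ 0 := by positivity
  field_simp
  linear_combination hs

theorem continuous_gapRate (hm : 0 ≤ m) : Continuous (gapRate m) := by
  unfold gapRate
  refine Continuous.div continuous_const (by fun_prop) fun p => ?_
  positivity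

end

/-- The law of a gap with mean `m`. -/
noncomputable def meanGapLaw (m p : ℝ) : Measure ℕ := gapLaw (m * gapRate m p) (1 - gapRate m p)

section

variable {m p : ℝ}

theorem isProbabilityMeasure_meanGapLaw (hm : 0 ≤ m) (hp : p ≤ 1) :
    IsProbabilityMeasure (meanGapLaw m p) :=
  isProbabilityMeasure_gapLaw (mul_nonneg hm (gapRate_pos hm).le)
    (sub_nonneg.2 (gapRate_le_one hm hp)) (by linarith [gapRate_pos (p := p) hm])

theorem lintegral_meanGapLaw (hm : 0 ≤ m) (hp : p ≤ 1) :
    ∫⁻ n, ENNReal.ofReal n ∂meanGapLaw m p = ENNReal.ofReal m := by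
  have h := gapRate_pos (p := p) hm
  rw [meanGapLaw, lintegral_gapLaw (mul_nonneg hm h.le) (mul_gapRate_le_one hm hp)
    (sub_nonneg.2 (gapRate_le_one hm hp)) (by linarith), sub_sub_cancel,
    mul_div_cancel_right₀ _ h.ne']

theorem ae_meanGapLaw_tendsto {v r ρ : ℝ} (hv : 0 ≤ v) (hr : 0 ≤ r) (hρ : 0 < ρ) (hm : 0 ≤ m)
    (hp : p ≤ 1) (hd : 2 * r + v * m = ρ⁻¹) : ∀ᵐ ω ∂rootedMeasure (meanGapLaw m p),
      Admissible r (position v r ω) ∧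
      Tendsto (fun N : ℕ => position v r ω N / N) atTop (𝓝 ρ⁻¹) := by
  have := isProbabilityMeasure_meanGapLaw hm hp
  filter_upwards [ae_rootedMeasure_tendsto (v := v) (r := r) hm (lintegral_meanGapLaw hm hp)]
    with ω ⟨h1, h2⟩
  rw [hd] at h1 h2
  exact ⟨admissible_position hv hr (inv_pos.2 hρ) h1 h2, h1⟩

theorem isProbabilityMeasure_smul_configurationMeasure {v r ρ : ℝ} (hv : 0 ≤ v) (hr : 0 ≤ r)
    (hρ : 0 < ρ) (hm : 0 ≤ m) (hp : p ≤ 1) (hd : 2 * r + v * m = ρ⁻¹) :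
    IsProbabilityMeasure (ENNReal.ofReal ρ • configurationMeasure v hr (meanGapLaw m p)) := by
  have := isProbabilityMeasure_meanGapLaw hm hp
  constructor
  rw [Measure.smul_apply, configurationMeasure_apply hr .univ, Set.preimage_univ, Set.univ_inter,
    rootedMeasure_originCell hv hr (lintegral_meanGapLaw hm hp), ← ENNReal.ofReal_mul hv,
    ← ENNReal.ofReal_add (by positivity) (by positivity), hd, smul_eq_mul,
    ← ENNReal.ofReal_mul hρ.le, mul_inv_cancel₀ hρ.ne', ENNReal.ofReal_one]

end

end Traffic

theorem theorem1 (v r ρ : ℝ) (hv : 0 < v) (hr : 0 ≤ r) (hρ : 0 < ρ) (hρr : ρ * (2 * r) ≤ 1) :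
    ∃ μ : I → ProbabilityMeasure (Traffic.Configuration r),
      (∀ p : I, 0 < p →
        (Traffic.process p hv.le r).Invariant (μ p : Measure (Traffic.Configuration r)) ∧
        (∀ c : Traffic.Configuration r, (μ p : Measure (Traffic.Configuration r)) {c} = 0) ∧
        ∀ᵐ c ∂(μ p : Measure (Traffic.Configuration r)), Traffic.HasDensity c ρ) ∧
      Tendsto μ (𝓝[<] 1) (𝓝 (μ 1)) := by
  open Traffic in
  -- The mean gap, in units of `v`, which makes the mean distance of neighbours `ρ⁻¹`.
  obtain ⟨m, hm, hd⟩ : ∃ m : ℝ, 0 ≤ m ∧ 2 * r + v * m = ρ⁻¹ := by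
    refine ⟨(ρ⁻¹ - 2 * r) / v, div_nonneg ?_ hv.le, by field_simp; ring⟩
    rwa [sub_nonneg, ← one_div, le_div_iff₀' hρ]
  have hprob (p : I) := isProbabilityMeasure_smul_configurationMeasure hv.le hr hρ hm p.2.2 hd
  have hlaw (p : I) := isProbabilityMeasure_meanGapLaw hm p.2.2
  have hae (p : I) := ae_meanGapLaw_tendsto hv.le hr hρ hm p.2.2 hd
  have hadm (p : I) := (hae p).mono fun ω h => h.1
  have h0 (p : I) : 0 < gapRate m p := gapRate_pos hm
  have h1 (p : I) : 0 ≤ 1 - gapRate m p := sub_nonneg.2 (gapRate_le_one hm p.2.2)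
  have h2 (p : I) : 1 - gapRate m p < 1 := by linarith [h0 p]
  have h3 (p : I) : 0 ≤ m * gapRate m p := mul_nonneg hm (h0 p).le
  have h4 (p : I) : m * gapRate m p ≤ 1 := mul_gapRate_le_one hm p.2.2
  refine ⟨fun p => ⟨_, hprob p⟩, fun p _ => ⟨?_, fun c => ?_, ?_⟩, ?_⟩
  · have := hlaw p
    have h := invariant_configurationMeasure (γ := meanGapLaw m p) hv.le hr
      (measurePreserving_gapStep (h3 p) (h4 p) (h1 p) (h2 p) p (gapRate_balance hm p.2.2)) (hadm p)
    exact (Measure.bind_smul _ _ _).trans (congrArg _ h)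
  · change (ENNReal.ofReal ρ • configurationMeasure v hr (meanGapLaw m p)) {c} = 0
    have := hlaw p
    rw [Measure.smul_apply, configurationMeasure_singleton hr (hadm p), smul_zero]
  · have h := ae_hasDensity hr (inv_pos.2 hρ) (hadm p) ((hae p).mono fun ω h => h.2)
    rw [inv_inv] at h
    exact Measure.ae_smul_measure h _
  · refine tendsto_of_seq_tendsto fun u hu => tendsto_of_forall_isOpen_le_liminf_nat' fun B hB => ?_
    have hu1 : Tendsto (fun k => gapRate m (u k)) atTop (𝓝 (gapRate m (1 : I))) :=
      (((continuous_gapRate hm).comp continuous_subtype_val).tendsto _).comp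
        (hu.mono_right nhdsWithin_le_nhds)
    have hlim := configurationMeasure_le_liminf hr
      (measurable_gapQuantile (h3 1) (h1 1) (h2 1).le)
      (fun k => measurable_gapQuantile (h3 (u k)) (h1 (u k)) (h2 (u k)).le)
      (ae_eventually_gapQuantile_eq (h3 1) (h4 1) (h1 1) (h2 1) (fun k => h3 (u k))
        (fun k => h1 (u k)) (fun k => (h2 (u k)).le) (hu1.const_mul m) (hu1.const_sub 1))
      (hadm 1) (fun k => hadm (u k)) hB
    change ENNReal.ofReal ρ * configurationMeasure v hr (meanGapLaw m (1 : I)) B ≤ liminf (fun k =>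
      ENNReal.ofReal ρ * configurationMeasure v hr (meanGapLaw m (u k)) B) atTop
    rw [ENNReal.liminf_const_mul_of_ne_top ENNReal.ofReal_ne_top]
    gcongr
    exact hlim
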